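/- **Period matrices.** Let $J=\begin{pmatrix}0&\mathbf 1_g\\-\mathbf 1_g&0\end{pmatrix}$. Let $\mathcal R_g$ be the set of matrices $\Omega=[\Omega_1\;\Omega_2]$ with $\Omega_1,\Omega_2\in M_g(\mathbb C)$, whose $2g$ columns form a real basis of $\mathbb C^g$, and which satisfy $\Omega J\,{}^t\Omega=0$ and $H_\Omega:=2i\,(\overline\Omega J^{-1}\,{}^t\Omega)^{-1}>0$. Such an $\Omega$ defines the abelian variety $A_\Omega=\mathbb C^g/\Omega\mathbb Z^{2g}$, principally polarized by $H_\Omega$, and its Riemann matrix $\tau(\Omega)=\Omega_2^{-1}\Omega_1$. **Theta constants.** For $\varepsilon_1,\varepsilon_2\in\mathbb Z^g$ put $$\theta\!\left[{\varepsilon_1\atop\varepsilon_2}\right]\!(\tau)=\sum_{n\in\mathbb Z^g}\exp\Big(\pi i\big({}^t(n+\tfrac{\varepsilon_1}{2})\,\tau\,(n+\tfrac{\varepsilon_1}{2})+{}^t(n+\tfrac{\varepsilon_1}{2})\,\varepsilon_2\big)\Big).$$ For $\Omega\in\mathcal R_3$ put $\chi_{18}(\Omega)=\det(\Omega_2)^{-18}\prod_{\varepsilon}\theta[\varepsilon](\tau(\Omega))$,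 the product being over the $36$ even characteristics, that is, over all $\varepsilon_1,\varepsilon_2\in\{0,1\}^3$ with $\varepsilon_1\cdot\varepsilon_2$ even. **Symmetric matrices.** For a symmetric matrix $m\in M_3(\mathbb C)$ with diagonal entries $a_1,a_2,a_3$ and cofactors $c_i$ of the $a_i$, put $$\mathsf X(m)=(a_1a_2a_3)^4\,(c_1c_2c_3)^2\,\det m .$$ Let $\mathsf S$ be the set of those $m$ with $a_1a_2a_3\ne0$ and $c_1c_2c_3\neq 0$. **Triples of elliptic curves.** Let $\widetilde{\mathsf A}$ be the set of pairs $(A,\rho)$, where $A$ is a product of three elliptic curves $E_i:y^2=x(x^2-4b_ix-4c_i)$ over $\mathbb C$ and $\rho\in\mathbb C^\times$ satisfies $\rho^2=\delta_1\delta_2\delta_3$ with $\delta_i=b_i^2+c_i$. For such a pair put $$\mathbf{Mat}(A,\rho)=\begin{pmatrix}\rho/\delta_1&b_3&b_2\\ b_3&\rho/\delta_2&b_1\\ b_2&b_1&\rho/\delta_3\end{pmatrix}.$$ **The objects attached to $\Omega$.** Let $[\omega_{1i}\;\omega_{2i}]\in\mathcal R_1$ for $i=1,2,3$, and put $\tau_i=\omega_{1i}/\omega_{2i}$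 and $$\Omega=\big[\operatorname{diag}(\omega_{11},\omega_{12},\omega_{13})\;\;\operatorname{diag}(\omega_{21},\omega_{22},\omega_{23})\big].$$ To $\Omega$ attach the product $A(\Omega)$ of the three curves $$y^2=x\Big(x+\tfrac{\pi^2}{\omega_{2i}^2}\theta\!\left[{0\atop0}\right]\!(\tau_i)^4\Big)\Big(x+\tfrac{\pi^2}{\omega_{2i}^2}\theta\!\left[{0\atop1}\right]\!(\tau_i)^4\Big),$$ that is, $E_i$ with $b_i=-\frac{\pi^2}{4\omega_{2i}^2}\big(\theta[{0\atop0}](\tau_i)^4+\theta[{0\atop1}](\tau_i)^4\big)$ and $c_i=-\frac{\pi^4}{4\omega_{2i}^4}\theta[{0\atop0}](\tau_i)^4\theta[{0\atop1}](\tau_i)^4$. Attach also the number $$\rho(\Omega)=-\frac{\pi^6}{64(\det\Omega_2)^2}\;\theta\!\left[{1\,1\,1\atop 0\,0\,0}\right]\!(\tau(\Omega))^4,\qquad \det\Omega_2=\omega_{21}\omega_{22}\omega_{23},$$ and the matrix $m=m(\Omega)=\mathbf{Mat}(A(\Omega),\rho(\Omega))$. As a complex torus, $A(\Omega)$ is $A_\Omega=\mathbb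 C^3/\Omega\mathbb Z^6=\prod_i\mathbb C/(\mathbb Z\omega_{1i}+\mathbb Z\omega_{2i})$. Let $P_i,Q_i$ be the classes of $\omega_{1i}/2,\ \omega_{2i}/2$ and $R_i=P_i+Q_i$. Let $W\subset A_\Omega[2]$ be the subgroup $$W=\{(O,O,O),(O,Q_2,Q_3),(Q_1,O,Q_3),(Q_1,Q_2,O),(P_1,P_2,P_3),(P_1,R_2,R_3),(R_1,P_2,R_3),(R_1,R_2,P_3)\}.$$ **Theorem.** One has $(A(\Omega),\rho(\Omega))\in\widetilde{\mathsf A}$ and $m(\Omega)\in\mathsf S$. Let $\Omega'\in\mathcal R_3$ be any period matrix of $A_\Omega/W$ with the principal polarization induced by twice the polarization of $A_\Omega$; that is, $\Omega'\mathbb Z^6$ is the preimage of $W$ in $\mathbb C^3$ and $H_{\Omega'}=2H_\Omega$. Then $$\Big(\frac{\pi}{2}\Big)^{54}\chi_{18}(\Omega')=\mathsf X(m(\Omega)).$$ -/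

import Mathlib

noncomputable section

open scoped ComplexOrder

namespace Ciani

/-! ### Period matrices and complex tori -/

/-- Complex `g × 2g` matrices `[Ω₁ Ω₂]`; the columns of `Ω₁` are indexed by `Sum.inl`,
those of `Ω₂` by `Sum.inr`. -/
abbrev PMat (g : ℕ) : Type := Matrix (Fin g) (Fin g ⊕ Fin g) ℂ

/-- The matrix `J = [0 1; -1 0]`. -/
def stdJ (g : ℕ) : Matrix (Fin g ⊕ Fin g) (Fin g ⊕ Fin g) ℂ :=
  Matrix.fromBlocks 0 1 (-1) 0

/-- The hermitian matrix `2i (conj Ω · J⁻¹ · ᵗΩ)⁻¹` representing the polarization attached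
to `Ω`. -/
def polarization {g : ℕ} (Ω : PMat g) : Matrix (Fin g) (Fin g) ℂ :=
  (2 * Complex.I) • (Ω.map (starRingEnd ℂ) * (stdJ g)⁻¹ * Ω.transpose)⁻¹

/-- The set `R_g` of period matrices: the `2g` columns are a real basis of `ℂ^g` and the
Riemann conditions hold. -/
def periodMatrices (g : ℕ) : Set (PMat g) :=
  {Ω | LinearIndependent ℝ (fun j : Fin g ⊕ Fin g => (fun i : Fin g => Ω i j)) ∧
    Ω * stdJ g * Ω.transpose = 0 ∧ (polarization Ω).PosDef}

/-- The Riemann matrix `τ(Ω) = Ω₂⁻¹ Ω₁`. -/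
def riemannMatrix {g : ℕ} (Ω : PMat g) : Matrix (Fin g) (Fin g) ℂ :=
  Ω.toCols₂⁻¹ * Ω.toCols₁

/-- The lattice `Ω ℤ^{2g} ⊆ ℂ^g`. -/
def lattice {g : ℕ} (Ω : PMat g) : AddSubgroup (Fin g → ℂ) :=
  AddSubgroup.closure (Set.range fun j : Fin g ⊕ Fin g => (fun i : Fin g => Ω i j))

/-- The complex torus `A_Ω = ℂ^g / Ω ℤ^{2g}`. -/
abbrev Torus {g : ℕ} (Ω : PMat g) : Type := (Fin g → ℂ) ⧸ lattice Ω

/-- The preimage in `ℂ^g` of a subgroup `W` of `A_Ω`; it is the lattice of `A_Ω / W`. -/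
def quotientLattice {g : ℕ} (Ω : PMat g) (W : AddSubgroup (Torus Ω)) :
    AddSubgroup (Fin g → ℂ) :=
  W.comap (QuotientAddGroup.mk' (lattice Ω))

/-- `Ω'` is a period matrix of `A_Ω / W` with the polarization induced by twice the polarization
of `A_Ω`. -/
def IsQuotientPeriodMatrix {g : ℕ} (Ω : PMat g) (W : AddSubgroup (Torus Ω)) (Ω' : PMat g) :
    Prop :=
  Ω' ∈ periodMatrices g ∧ lattice Ω' = quotientLattice Ω W ∧
    polarization Ω' = (2 : ℂ) • polarization Ω

/-! ### Theta functions -/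

/-- The theta function with characteristic `[ε₁; ε₂]`. -/
def theta {g : ℕ} (ε₁ ε₂ : Fin g → ℤ) (z : Fin g → ℂ) (τ : Matrix (Fin g) (Fin g) ℂ) : ℂ :=
  ∑' n : Fin g → ℤ,
    Complex.exp (Real.pi * Complex.I *
      ((fun i => (n i : ℂ) + (ε₁ i : ℂ) / 2) ⬝ᵥ
          τ.mulVec (fun i => (n i : ℂ) + (ε₁ i : ℂ) / 2) +
        2 * ((fun i => (n i : ℂ) + (ε₁ i : ℂ) / 2) ⬝ᵥ (fun i => z i + (ε₂ i : ℂ) / 2))))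

/-- The Thetanullwert with characteristic `[ε₁; ε₂]`. -/
def thetaNull {g : ℕ} (ε₁ ε₂ : Fin g → ℤ) (τ : Matrix (Fin g) (Fin g) ℂ) : ℂ :=
  theta ε₁ ε₂ 0 τ

/-- The set `S_g` of even characteristics with entries in `{0, 1}`. -/
def evenChars (g : ℕ) : Finset ((Fin g → Fin 2) × (Fin g → Fin 2)) :=
  Finset.univ.filter fun e => Even (∑ i, (e.1 i : ℕ) * (e.2 i : ℕ))

/-- The product of all even Thetanullwerte. -/
def chi {g : ℕ} (τ : Matrix (Fin g) (Fin g) ℂ) : ℂ :=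
  ∏ e ∈ evenChars g,
    thetaNull (fun i => (((e.1 i : ℕ) : ℤ))) (fun i => (((e.2 i : ℕ) : ℤ))) τ

/-- The modular form `χ₁₈` of weight `18` as a function of period matrices:
`χ₁₈(Ω) = det(Ω₂)^{-18} χ₁₈(τ(Ω))`. -/
def chi18 (Ω : PMat 3) : ℂ :=
  (Ω.toCols₂.det ^ 18)⁻¹ * chi (riemannMatrix Ω)

/-! ### Triples of elliptic curves and symmetric matrices -/

/-- Coefficients of three curves `E i : y² = x (x² - 4 (b i) x - 4 (c i))`, and a scalar `ρ`. -/
structure CurveTriple where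
  b : Fin 3 → ℂ
  c : Fin 3 → ℂ
  ρ : ℂ

/-- The curve `E i : y² = x (x² - 4 (b i) x - 4 (c i))`. -/
def CurveTriple.curve (t : CurveTriple) (i : Fin 3) : WeierstrassCurve ℂ where
  a₁ := 0
  a₂ := -4 * t.b i
  a₃ := 0
  a₄ := -4 * t.c i
  a₆ := 0

/-- `δ i = (b i)² + c i`. -/
def CurveTriple.δ (t : CurveTriple) (i : Fin 3) : ℂ := t.b i ^ 2 + t.c i

/-- The set of pairs `(A, ρ)`: `A` is a product of three elliptic curves of the above form and
`ρ` a nonzero square root of `δ₁ δ₂ δ₃`. -/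
def markedTriples : Set CurveTriple :=
  {t | (∀ i, (t.curve i).IsElliptic) ∧ t.ρ ≠ 0 ∧ t.ρ ^ 2 = ∏ i, t.δ i}

/-- The symmetric matrix with diagonal `a i = ρ / δ i` and off-diagonal entries the `b i`. -/
def CurveTriple.Mat (t : CurveTriple) : Matrix (Fin 3) (Fin 3) ℂ :=
  !![t.ρ / t.δ 0, t.b 2, t.b 1;
     t.b 2, t.ρ / t.δ 1, t.b 0;
     t.b 1, t.b 0, t.ρ / t.δ 2]

/-- Symmetric matrices whose diagonal entries `a i` and their cofactors `c i` are all nonzero. -/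
def S : Set (Matrix (Fin 3) (Fin 3) ℂ) :=
  {m | m.IsSymm ∧ (∏ i, m i i) ≠ 0 ∧ (∏ i, m.adjugate i i) ≠ 0}

/-- `X(m) = (a₁a₂a₃)⁴ (c₁c₂c₃)² det m`, with `c i` the cofactor of the diagonal entry `a i`. -/
def X (m : Matrix (Fin 3) (Fin 3) ℂ) : ℂ :=
  (∏ i, m i i) ^ 4 * (∏ i, m.adjugate i i) ^ 2 * m.det

/-! ### The objects attached to a diagonal period matrix -/

/-- The period matrix `[ω₁ ω₂]` of size `1 × 2`. -/
def pairMatrix (ω₁ ω₂ : ℂ) : PMat 1 := Matrix.fromCols !![ω₁] !![ω₂]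

/-- The period matrix `[diag(ω₁) diag(ω₂)]` of size `3 × 6`. -/
def diagPeriod (ω₁ ω₂ : Fin 3 → ℂ) : PMat 3 :=
  Matrix.fromCols (Matrix.diagonal ω₁) (Matrix.diagonal ω₂)

/-- The number `(π/ω₂)² θ[0; ε](ω₁/ω₂)⁴`; the curve `E(ω₁, ω₂)` attached to the lattice
`ℤ ω₁ + ℤ ω₂` is `y² = x (x + thetaRoot ω₁ ω₂ 0) (x + thetaRoot ω₁ ω₂ 1)`. -/
def thetaRoot (ω₁ ω₂ : ℂ) (ε : ℤ) : ℂ :=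
  (Real.pi : ℂ) ^ 2 / ω₂ ^ 2 *
    thetaNull (fun _ : Fin 1 => 0) (fun _ => ε) (riemannMatrix (pairMatrix ω₁ ω₂)) ^ 4

/-- The pair `(A(Ω), ρ(Ω))` attached to `Ω = [diag(ω₁) diag(ω₂)]`. The sign of `ρ` is such that
`ρ = ρ₁ρ₂ρ₃`, where `2 b i + 2 ρ i` is the abscissa of the point of `E i` that corresponds to
`ω₁ i / 2`. -/
def curveTriple (ω₁ ω₂ : Fin 3 → ℂ) : CurveTriple where
  b i := -(thetaRoot (ω₁ i) (ω₂ i) 0 + thetaRoot (ω₁ i) (ω₂ i) 1) / 4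
  c i := -(thetaRoot (ω₁ i) (ω₂ i) 0 * thetaRoot (ω₁ i) (ω₂ i) 1) / 4
  ρ := -((Real.pi : ℂ) ^ 6 / (64 * (diagPeriod ω₁ ω₂).toCols₂.det ^ 2)) *
    thetaNull (fun _ => 1) (fun _ => 0) (riemannMatrix (diagPeriod ω₁ ω₂)) ^ 4

/-- With `P i`, `Q i` the classes of the half periods `ω₁ i / 2`, `ω₂ i / 2` and
`R i = P i + Q i`, the subgroup
`{(O,O,O), (O,Q,Q), (Q,O,Q), (Q,Q,O), (P,P,P), (P,R,R), (R,P,R), (R,R,P)}`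
of the `2`-torsion of `A(Ω)`, given by its basis `(O,Q,Q), (Q,Q,O), (P,P,P)` over `𝔽₂`. -/
def subgroupW (ω₁ ω₂ : Fin 3 → ℂ) : AddSubgroup (Torus (diagPeriod ω₁ ω₂)) :=
  AddSubgroup.closure (QuotientAddGroup.mk ''
    {![0, ω₂ 1 / 2, ω₂ 2 / 2],
     ![ω₂ 0 / 2, ω₂ 1 / 2, 0],
     ![ω₁ 0 / 2, ω₁ 1 / 2, ω₁ 2 / 2]})

end Ciani

end

/-!
Both sides of the formula are computed as polynomials in the theta constants of the three curves.

`χ₁₈` takes the same value at all period matrices of a principally polarized abelian threefold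
(`chi18_eq_of_lattice_le`). Indeed, two such matrices differ by an integral symplectic matrix
(`IsRiemann.mem_symplecticGroup`), and `Sp₆(ℤ)` is generated by translations of `τ` and by the
inversions of a single coordinate (`exists_mul_eq_one_of_mem_symplecticGroup`). Under these
generators the theta constants are permuted up to eighth roots of unity and a common factor, by a
change of summation index or by Poisson summation in one variable; over the 36 even characteristics
the roots of unity multiply to `1` for a translation and to `-1` for an inversion (`chi_add_single`,
`chi_add_single_add_single`, `chi_partialInv`).

So it suffices to treat one period matrix `quotientPeriod ω₁ ω₂` of `A_Ω / W`. Its Riemann matrix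
`isogenyMatrix τ` belongs to the quadratic form `2 ∑ τ i (x i)²` on the body centred cubic lattice.
This lattice consists of two cosets of `ℤ³`, hence each theta constant is a sum of two products of
theta series of the form `θ(2 τ i)`, with upper characteristic in `ℤ / 4`
(`thetaNull_isogenyMatrix`). All 36 of them become explicit. The duplication formulas, which are
instances of `thetaSum_mul_thetaSum`, then turn their product into a polynomial in
`θ₂(τ i)`, `θ₃(τ i)`, `θ₄(τ i)` (`chi_isogenyMatrix`).

On the other side, Jacobi's identity gives `δ i = (r i)²` with
`r i = π² θ₂(τ i)⁴ / (4 (ω₂ i)²)`, and `ρ = -r₀r₁r₂`. So the `i`-th diagonal cofactor of the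
matrix is the coefficient `c i` of the curve, and `X` becomes the same polynomial
(`X_mat_curveTriple`). As the theta constants of one variable do not vanish on the upper half plane,
the curves are elliptic and the matrix lies in `S`.
-/

namespace Ciani

open Matrix

/-! ### Generation of the integral symplectic group -/

section Generation

variable {l : Type*} [Fintype l] [DecidableEq l]

/-- The elementary symplectic matrix whose right multiplication sends a row `(x | y)` to the row
with `x i + k * y i` in place of `x i`. -/
def longRoot (i : l) (k : ℤ) : Matrix (l ⊕ l) (l ⊕ l) ℤ :=
  1 + Matrix.single (Sum.inr i) (Sum.inl i) k

/-- The elementary symplectic matrix whose right multiplication adds `k * y i` to `x j` and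
`k * y j` to `x i` in a row `(x | y)`. -/
def shortRoot (i j : l) (k : ℤ) : Matrix (l ⊕ l) (l ⊕ l) ℤ :=
  1 + Matrix.single (Sum.inr i) (Sum.inl j) k + Matrix.single (Sum.inr j) (Sum.inl i) k

/-- The partial inversion at `i`: right multiplication sends `(x i, y i)` to `(y i, -x i)`. -/
def partialJ (i : l) : Matrix (l ⊕ l) (l ⊕ l) ℤ :=
  1 - Matrix.single (Sum.inl i) (Sum.inl i) 1 - Matrix.single (Sum.inr i) (Sum.inr i) 1
    + Matrix.single (Sum.inr i) (Sum.inl i) 1 - Matrix.single (Sum.inl i) (Sum.inr i) 1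

/-- The transpose of `longRoot`: right multiplication adds `k * x i` to `y i`. -/
def longRootLower (i : l) (k : ℤ) : Matrix (l ⊕ l) (l ⊕ l) ℤ :=
  1 + Matrix.single (Sum.inl i) (Sum.inr i) k

/-- The shear: right multiplication adds `k * x j` to `x i` and `-k * y i` to `y j`. -/
def shear (i j : l) (k : ℤ) : Matrix (l ⊕ l) (l ⊕ l) ℤ :=
  1 + Matrix.single (Sum.inl j) (Sum.inl i) k - Matrix.single (Sum.inr i) (Sum.inr j) k

theorem vecMul_single_eq {m n R : Type*} [Fintype m] [DecidableEq m] [DecidableEq n]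
    [CommRing R] (a : m) (b : n) (k : R) (r : m → R) :
    r ᵥ* Matrix.single a b k = Pi.single b (k * r a) := by
  ext c
  simp only [vecMul, dotProduct, Matrix.single_apply, Pi.single_apply]
  by_cases h : b = c
  · subst h; simp [mul_comm]
  · simp [h, Ne.symm h]

theorem vecMul_longRoot (i : l) (k : ℤ) (r : l ⊕ l → ℤ) :
    r ᵥ* longRoot i k = r + Pi.single (Sum.inl i) (k * r (Sum.inr i)) := by
  simp [longRoot, vecMul_add, vecMul_single_eq]

theorem vecMul_longRootLower (i : l) (k : ℤ) (r : l ⊕ l → ℤ) :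
    r ᵥ* longRootLower i k = r + Pi.single (Sum.inr i) (k * r (Sum.inl i)) := by
  simp [longRootLower, vecMul_add, vecMul_single_eq]

theorem vecMul_shortRoot (i j : l) (k : ℤ) (r : l ⊕ l → ℤ) :
    r ᵥ* shortRoot i j k = r + Pi.single (Sum.inl j) (k * r (Sum.inr i))
      + Pi.single (Sum.inl i) (k * r (Sum.inr j)) := by
  simp [shortRoot, vecMul_add, vecMul_single_eq]

theorem vecMul_shear (i j : l) (k : ℤ) (r : l ⊕ l → ℤ) :
    r ᵥ* shear i j k = r + Pi.single (Sum.inl i) (k * r (Sum.inl j))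
      - Pi.single (Sum.inr j) (k * r (Sum.inr i)) := by
  simp [shear, vecMul_add, vecMul_sub, vecMul_single_eq]

theorem vecMul_partialJ (i : l) (r : l ⊕ l → ℤ) :
    r ᵥ* partialJ i = r - Pi.single (Sum.inl i) (r (Sum.inl i))
      - Pi.single (Sum.inr i) (r (Sum.inr i)) + Pi.single (Sum.inl i) (r (Sum.inr i))
      - Pi.single (Sum.inr i) (r (Sum.inl i)) := by
  simp [partialJ, vecMul_add, vecMul_sub, vecMul_single_eq]

/-- Conjugation of `longRoot` by the partial inversion, whose inverse is its cube. -/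
theorem longRootLower_eq (i : l) (k : ℤ) :
    longRootLower i k
      = partialJ i * partialJ i * partialJ i * longRoot i (-k) * partialJ i := by
  refine Matrix.ext_of_single_vecMul fun a => ?_
  simp only [← vecMul_vecMul, vecMul_longRootLower, vecMul_longRoot, vecMul_partialJ]
  generalize (Pi.single a 1 : l ⊕ l → ℤ) = r
  ext (b | b) <;> by_cases hb : b = i <;> simp [hb, add_comm]

/-- Conjugation of `shortRoot` by the partial inversion at one of its two indices. -/
theorem shear_eq {i j : l} (h : i ≠ j) (k : ℤ) :
    shear i j k
      = partialJ j * partialJ j * partialJ j * shortRoot i j k * partialJ j := by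
  refine Matrix.ext_of_single_vecMul fun a => ?_
  simp only [← vecMul_vecMul, vecMul_shear, vecMul_shortRoot, vecMul_partialJ]
  generalize (Pi.single a 1 : l ⊕ l → ℤ) = r
  have h' := h.symm
  ext (b | b) <;> by_cases hb : b = i <;> by_cases hb' : b = j <;>
    simp_all; ring

/-- Euclid's algorithm on pairs of integers, as an induction principle. -/
theorem int_pair_euclid {Q : ℤ → ℤ → Prop} (h0 : ∀ x, Q x 0)
    (h1 : ∀ x y k, Q (x + k * y) y → Q x y) (h2 : ∀ x y k, Q x (y + k * x) → Q x y) :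
    ∀ x y, Q x y := by
  have hswap : ∀ x y, Q y (-x) → Q x y := fun x y h => by
    apply h1 x y 1
    apply h2 _ _ (-1)
    apply h1 _ _ 1
    convert h using 1 <;> ring
  suffices H : ∀ n : ℕ, ∀ x y : ℤ, y.natAbs = n → Q x y from fun x y => H _ x y rfl
  intro n
  induction n using Nat.strong_induction_on with
  | _ n ih =>
    intro x y hy
    by_cases hy0 : y = 0
    · subst hy0; exact h0 x
    · apply h1 x y (-(x / y))
      have e : x + -(x / y) * y = x % y := by rw [Int.emod_def]; ring
      rw [e]
      apply hswap
      refine ih _ ?_ y _ rfl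
      rw [← hy, Int.natAbs_neg]
      have h1 := Int.emod_lt_abs x hy0
      have h2 := Int.emod_nonneg x hy0
      rw [Int.abs_eq_natAbs] at h1
      omega

/-- The submonoid of matrices fixing a set of row vectors. -/
def fixing (V : Set (l ⊕ l → ℤ)) : Submonoid (Matrix (l ⊕ l) (l ⊕ l) ℤ) where
  carrier := {E | ∀ v ∈ V, v ᵥ* E = v}
  one_mem' := by simp
  mul_mem' := by
    intro a b ha hb v hv
    rw [← vecMul_vecMul, ha v hv, hb v hv]

/-- Euclid's algorithm on the pair `(x i, y i)` in a row `(x | y)`. -/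
theorem exists_kill_inr {𝓕 : Submonoid (Matrix (l ⊕ l) (l ⊕ l) ℤ)} {i : l}
    (hA : ∀ k, longRoot i k ∈ 𝓕) (hL : ∀ k, longRootLower i k ∈ 𝓕) (r : l ⊕ l → ℤ) :
    ∃ E ∈ 𝓕, (r ᵥ* E) (Sum.inr i) = 0 ∧
      ∀ b, b ≠ Sum.inl i → b ≠ Sum.inr i → (r ᵥ* E) b = r b := by
  suffices H : ∀ x y : ℤ, ∀ r : l ⊕ l → ℤ, r (Sum.inl i) = x → r (Sum.inr i) = y →
      ∃ E ∈ 𝓕, (r ᵥ* E) (Sum.inr i) = 0 ∧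
        ∀ b, b ≠ Sum.inl i → b ≠ Sum.inr i → (r ᵥ* E) b = r b from H _ _ r rfl rfl
  refine int_pair_euclid ?_ ?_ ?_
  · intro x r _ h
    exact ⟨1, one_mem _, by simp [h], by simp⟩
  · intro x y k ih r hx hy
    obtain ⟨E, hE, h0, h1⟩ := ih (r ᵥ* longRoot i k) (by simp [vecMul_longRoot, hx, hy])
      (by simp [vecMul_longRoot, hy])
    refine ⟨longRoot i k * E, mul_mem (hA k) hE, by rwa [← vecMul_vecMul], fun b hb hb' => ?_⟩
    rw [← vecMul_vecMul, h1 b hb hb']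
    simp [vecMul_longRoot, hb]
  · intro x y k ih r hx hy
    obtain ⟨E, hE, h0, h1⟩ := ih (r ᵥ* longRootLower i k) (by simp [vecMul_longRootLower, hx])
      (by simp [vecMul_longRootLower, hx, hy])
    refine ⟨longRootLower i k * E, mul_mem (hL k) hE, by rwa [← vecMul_vecMul],
      fun b hb hb' => ?_⟩
    rw [← vecMul_vecMul, h1 b hb hb']
    simp [vecMul_longRootLower, hb']

/-- Euclid's algorithm on the pair `(x j, x i)` in a row `(x | y)` with `y i = y j = 0`. -/
theorem exists_kill_inl {𝓕 : Submonoid (Matrix (l ⊕ l) (l ⊕ l) ℤ)} {i j : l} (hij : i ≠ j)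
    (h1 : ∀ k, shear i j k ∈ 𝓕) (h2 : ∀ k, shear j i k ∈ 𝓕) (r : l ⊕ l → ℤ)
    (hi : r (Sum.inr i) = 0) (hj : r (Sum.inr j) = 0) :
    ∃ E ∈ 𝓕, (r ᵥ* E) (Sum.inl i) = 0 ∧
      ∀ b, b ≠ Sum.inl i → b ≠ Sum.inl j → (r ᵥ* E) b = r b := by
  suffices H : ∀ x y : ℤ, ∀ r : l ⊕ l → ℤ, r (Sum.inl j) = x → r (Sum.inl i) = y →
      r (Sum.inr i) = 0 → r (Sum.inr j) = 0 → ∃ E ∈ 𝓕, (r ᵥ* E) (Sum.inl i) = 0 ∧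
        ∀ b, b ≠ Sum.inl i → b ≠ Sum.inl j → (r ᵥ* E) b = r b from H _ _ r rfl rfl hi hj
  clear hi hj r
  refine int_pair_euclid ?_ ?_ ?_
  · intro x r _ h _ _
    exact ⟨1, one_mem _, by simp [h], by simp⟩
  · intro x y k ih r hx hy hi hj
    obtain ⟨E, hE, h3, h4⟩ := ih (r ᵥ* shear j i k) (by simp [vecMul_shear, hx, hy])
      (by simp [vecMul_shear, hy, hij]) (by simp [vecMul_shear, hi, hj])
      (by simp [vecMul_shear, hj])
    refine ⟨shear j i k * E, mul_mem (h2 k) hE, by rwa [← vecMul_vecMul], fun b hb hb' => ?_⟩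
    rw [← vecMul_vecMul, h4 b hb hb']
    simp [vecMul_shear, hb', hj]
  · intro x y k ih r hx hy hi hj
    obtain ⟨E, hE, h3, h4⟩ := ih (r ᵥ* shear i j k) (by simp [vecMul_shear, hx, hij.symm])
      (by simp [vecMul_shear, hx, hy]) (by simp [vecMul_shear, hi])
      (by simp [vecMul_shear, hi, hj])
    refine ⟨shear i j k * E, mul_mem (h1 k) hE, by rwa [← vecMul_vecMul], fun b hb hb' => ?_⟩
    rw [← vecMul_vecMul, h4 b hb hb']
    simp [vecMul_shear, hb, hi]

theorem exists_kill_inr_finset {𝓕 : Submonoid (Matrix (l ⊕ l) (l ⊕ l) ℤ)} (F : Finset l)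
    (hA : ∀ i ∈ F, ∀ k, longRoot i k ∈ 𝓕) (hL : ∀ i ∈ F, ∀ k, longRootLower i k ∈ 𝓕)
    (r : l ⊕ l → ℤ) :
    ∃ E ∈ 𝓕, (∀ i ∈ F, (r ᵥ* E) (Sum.inr i) = 0) ∧
      ∀ i ∉ F, (r ᵥ* E) (Sum.inl i) = r (Sum.inl i) ∧ (r ᵥ* E) (Sum.inr i) = r (Sum.inr i) := by
  induction F using Finset.induction_on with
  | empty => exact ⟨1, one_mem _, by simp, by simp⟩
  | insert j F hj ih =>
    obtain ⟨E, hE, h0, h1⟩ := ih (fun i hi => hA i (by simp [hi])) (fun i hi => hL i (by simp [hi]))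
    obtain ⟨E', hE', h0', h1'⟩ := exists_kill_inr (hA j (by simp)) (hL j (by simp)) (r ᵥ* E)
    refine ⟨E * E', mul_mem hE hE', ?_, ?_⟩
    · intro i hi
      rw [← vecMul_vecMul]
      rcases Finset.mem_insert.1 hi with rfl | hi'
      · exact h0'
      · have : i ≠ j := fun h => hj (h ▸ hi')
        rw [h1' _ (by simp) (by simpa using this), h0 i hi']
    · intro i hi
      simp only [Finset.mem_insert, not_or] at hi
      rw [← vecMul_vecMul, h1' _ (by simpa using hi.1) (by simp),
        h1' _ (by simp) (by simpa using hi.1)]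
      exact h1 i hi.2

theorem exists_kill_inl_finset {𝓕 : Submonoid (Matrix (l ⊕ l) (l ⊕ l) ℤ)} (F : Finset l)
    {j : l} (hjF : j ∉ F) (h1 : ∀ i ∈ F, ∀ k, shear i j k ∈ 𝓕)
    (h2 : ∀ i ∈ F, ∀ k, shear j i k ∈ 𝓕) (r : l ⊕ l → ℤ)
    (hr : ∀ i, r (Sum.inr i) = 0) :
    ∃ E ∈ 𝓕, (∀ i ∈ F, (r ᵥ* E) (Sum.inl i) = 0) ∧ (∀ i, (r ᵥ* E) (Sum.inr i) = 0) ∧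
      ∀ i ∉ F, i ≠ j → (r ᵥ* E) (Sum.inl i) = r (Sum.inl i) := by
  induction F using Finset.induction_on with
  | empty => exact ⟨1, one_mem _, by simp, by simpa using hr, by simp⟩
  | insert a F ha ih =>
    simp only [Finset.mem_insert, not_or] at hjF
    obtain ⟨E, hE, h3, h4, h5⟩ := ih hjF.2 (fun i hi => h1 i (by simp [hi]))
      (fun i hi => h2 i (by simp [hi]))
    obtain ⟨E', hE', h3', h4'⟩ := exists_kill_inl (Ne.symm hjF.1) (h1 a (by simp)) (h2 a (by simp))
      (r ᵥ* E) (h4 a) (h4 j)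
    refine ⟨E * E', mul_mem hE hE', ?_, ?_, ?_⟩
    · intro i hi
      rw [← vecMul_vecMul]
      rcases Finset.mem_insert.1 hi with rfl | hi'
      · exact h3'
      · have h6 : i ≠ a := fun h => ha (h ▸ hi')
        have h7 : i ≠ j := fun h => hjF.2 (h ▸ hi')
        rw [h4' _ (by simpa using h6) (by simpa using h7), h3 i hi']
    · intro i
      rw [← vecMul_vecMul, h4' _ (by simp) (by simp), h4]
    · intro i hi hij
      simp only [Finset.mem_insert, not_or] at hi
      rw [← vecMul_vecMul, h4' _ (by simpa using hi.1) (by simpa using hij)]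
      exact h5 i hi.2 hij

/-- A row `(x | y)` with `y j = 1` is cleared at the indices of `F` by `shear j i` and
`shortRoot i j`, which fix the basis vector of `x j`. -/
theorem exists_clear_finset {𝓕 : Submonoid (Matrix (l ⊕ l) (l ⊕ l) ℤ)} (F : Finset l)
    {j : l} (hjF : j ∉ F) (h1 : ∀ i ∈ F, ∀ k, shear j i k ∈ 𝓕)
    (h2 : ∀ i ∈ F, ∀ k, shortRoot i j k ∈ 𝓕) (r : l ⊕ l → ℤ) (hr : r (Sum.inr j) = 1) :
    ∃ E ∈ 𝓕, (r ᵥ* E) (Sum.inr j) = 1 ∧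
      (∀ i ∈ F, (r ᵥ* E) (Sum.inl i) = 0 ∧ (r ᵥ* E) (Sum.inr i) = 0) ∧
      ∀ i ∉ F, i ≠ j → (r ᵥ* E) (Sum.inl i) = r (Sum.inl i) ∧
        (r ᵥ* E) (Sum.inr i) = r (Sum.inr i) := by
  induction F using Finset.induction_on with
  | empty => exact ⟨1, one_mem _, by simpa using hr, by simp, by simp⟩
  | insert a F ha ih =>
    simp only [Finset.mem_insert, not_or] at hjF
    obtain ⟨E, hE, h3, h4, h5⟩ := ih hjF.2 (fun i hi => h1 i (by simp [hi]))
      (fun i hi => h2 i (by simp [hi]))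
    have hja : j ≠ a := hjF.1
    set s := r ᵥ* E with hs
    set E' := shear j a (s (Sum.inr a)) * shortRoot a j (-s (Sum.inl a)) with hE'
    have key : ∀ b, (s ᵥ* E') b = if b = Sum.inl a then 0 else if b = Sum.inr a then 0 else
        if b = Sum.inl j then s b + s (Sum.inr a) * s (Sum.inl a) else s b := by
      intro b
      rw [hE', ← vecMul_vecMul, vecMul_shortRoot, vecMul_shear]
      rcases b with b | b <;> by_cases hb : b = a <;> by_cases hb' : b = j <;>
        simp_all
    refine ⟨E * E', mul_mem hE (mul_mem (h1 a (by simp) _) (h2 a (by simp) _)), ?_, ?_, ?_⟩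
    · rw [← vecMul_vecMul, ← hs, key]; simp [hja, h3]
    · intro i hi
      rw [← vecMul_vecMul, ← hs, key, key]
      rcases Finset.mem_insert.1 hi with rfl | hi'
      · simp
      · have h7 : i ≠ j := fun h => hjF.2 (h ▸ hi')
        simp [h7, h4 i hi']
    · intro i hi hij
      simp only [Finset.mem_insert, not_or] at hi
      rw [← vecMul_vecMul, ← hs, key, key]
      simp [hi.1, hij, h5 i hi.2 hij]

/-- The rows of a symplectic matrix form a symplectic basis. -/
theorem symplectic_row_pairing {M : Matrix (l ⊕ l) (l ⊕ l) ℤ}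
    (hM : M ∈ Matrix.symplecticGroup l ℤ) (a b : l ⊕ l) :
    ∑ i, (M a (Sum.inr i) * M b (Sum.inl i) - M a (Sum.inl i) * M b (Sum.inr i))
      = Matrix.J l ℤ a b := by
  rw [SymplecticGroup.mem_iff] at hM
  rw [← hM]
  simp [Matrix.mul_apply, Matrix.J, Fintype.sum_sum_type, Matrix.one_apply, sub_eq_add_neg,
    Finset.sum_add_distrib]

/-- One step of the reduction: the two rows of a symplectic matrix at an index `j` are made
standard by elementary matrices which preserve the rows that are already standard. -/
theorem exists_reduction_step {𝓔 : Submonoid (Matrix (l ⊕ l) (l ⊕ l) ℤ)}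
    (hSp : 𝓔 ≤ Matrix.symplecticGroup l ℤ) (hA : ∀ i k, longRoot i k ∈ 𝓔)
    (hJ : ∀ i, partialJ i ∈ 𝓔) (hS : ∀ i j k, i ≠ j → shortRoot i j k ∈ 𝓔)
    (F : Finset l) {j : l} (hjF : j ∉ F) {M : Matrix (l ⊕ l) (l ⊕ l) ℤ}
    (hM : M ∈ Matrix.symplecticGroup l ℤ)
    (hstd : ∀ i ∉ insert j F, M (Sum.inl i) = Pi.single (Sum.inl i) 1 ∧
      M (Sum.inr i) = Pi.single (Sum.inr i) 1) :
    ∃ E ∈ 𝓔, ∀ i ∉ F, (M * E) (Sum.inl i) = Pi.single (Sum.inl i) 1 ∧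
      (M * E) (Sum.inr i) = Pi.single (Sum.inr i) 1 := by
  have hL : ∀ i k, longRootLower i k ∈ 𝓔 := fun i k => by
    rw [longRootLower_eq]
    exact mul_mem (mul_mem (mul_mem (mul_mem (hJ i) (hJ i)) (hJ i)) (hA _ _)) (hJ i)
  have hG : ∀ i j k, i ≠ j → shear i j k ∈ 𝓔 := fun i j k h => by
    rw [shear_eq h]
    exact mul_mem (mul_mem (mul_mem (mul_mem (hJ j) (hJ j)) (hJ j)) (hS _ _ _ h)) (hJ j)
  have row : ∀ (N E : Matrix (l ⊕ l) (l ⊕ l) ℤ) a, (N * E) a = N a ᵥ* E := fun N E a => rfl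
  -- The standard rows which are to be preserved.
  set V : Set (l ⊕ l → ℤ) := {v | ∃ i ∉ insert j F, v = Pi.single (Sum.inl i) 1 ∨
    v = Pi.single (Sum.inr i) 1} with hV
  have keep : ∀ (N E : Matrix (l ⊕ l) (l ⊕ l) ℤ), E ∈ fixing V →
      (∀ i ∉ insert j F, N (Sum.inl i) = Pi.single (Sum.inl i) 1 ∧
        N (Sum.inr i) = Pi.single (Sum.inr i) 1) →
      (∀ i ∉ insert j F, (N * E) (Sum.inl i) = Pi.single (Sum.inl i) 1 ∧
        (N * E) (Sum.inr i) = Pi.single (Sum.inr i) 1) := by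
    intro N E hE hN i hi
    rw [row, row, (hN i hi).1, (hN i hi).2]
    exact ⟨hE _ ⟨i, hi, Or.inl rfl⟩, hE _ ⟨i, hi, Or.inr rfl⟩⟩
  -- Rows paired to zero with the standard rows vanish at the corresponding indices.
  have vanish : ∀ (N : Matrix (l ⊕ l) (l ⊕ l) ℤ), N ∈ Matrix.symplecticGroup l ℤ →
      (∀ i ∉ insert j F, N (Sum.inl i) = Pi.single (Sum.inl i) 1 ∧
        N (Sum.inr i) = Pi.single (Sum.inr i) 1) →
      ∀ i ∉ insert j F, (N (Sum.inl j) (Sum.inl i) = 0 ∧ N (Sum.inl j) (Sum.inr i) = 0) ∧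
        (N (Sum.inr j) (Sum.inl i) = 0 ∧ N (Sum.inr j) (Sum.inr i) = 0) := by
    intro N hN hst i hi
    have hji : j ≠ i := fun h => hi (by simp [h])
    have e1 := symplectic_row_pairing hN (Sum.inl j) (Sum.inl i)
    have e2 := symplectic_row_pairing hN (Sum.inl j) (Sum.inr i)
    have e3 := symplectic_row_pairing hN (Sum.inr j) (Sum.inl i)
    have e4 := symplectic_row_pairing hN (Sum.inr j) (Sum.inr i)
    rw [(hst i hi).1] at e1 e3
    rw [(hst i hi).2] at e2 e4
    simp [Pi.single_apply, Matrix.J, hji] at e1 e2 e3 e4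
    exact ⟨⟨e2, e1⟩, e4, e3⟩
  set 𝓕 := 𝓔 ⊓ fixing V with h𝓕
  have hne : ∀ a ∈ insert j F, ∀ i ∉ insert j F, a ≠ i := fun a ha i hi h => hi (h ▸ ha)
  have hA' : ∀ a ∈ insert j F, ∀ k, longRoot a k ∈ 𝓕 := by
    refine fun a ha k => ⟨hA a k, ?_⟩
    rintro v ⟨i, hi, rfl | rfl⟩ <;> rw [vecMul_longRoot] <;> simp [hne a ha i hi]
  have hL' : ∀ a ∈ insert j F, ∀ k, longRootLower a k ∈ 𝓕 := by
    refine fun a ha k => ⟨hL a k, ?_⟩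
    rintro v ⟨i, hi, rfl | rfl⟩ <;> rw [vecMul_longRootLower] <;> simp [hne a ha i hi]
  have hG' : ∀ a ∈ insert j F, ∀ b ∈ insert j F, a ≠ b → ∀ k, shear a b k ∈ 𝓕 := by
    refine fun a ha b hb hab k => ⟨hG a b k hab, ?_⟩
    rintro v ⟨i, hi, rfl | rfl⟩ <;> rw [vecMul_shear] <;> simp [hne a ha i hi, hne b hb i hi]
  have hS' : ∀ a ∈ insert j F, ∀ b ∈ insert j F, a ≠ b → ∀ k, shortRoot a b k ∈ 𝓕 := by
    refine fun a ha b hb hab k => ⟨hS a b k hab, ?_⟩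
    rintro v ⟨i, hi, rfl | rfl⟩ <;> rw [vecMul_shortRoot] <;> simp [hne a ha i hi, hne b hb i hi]
  have hJ' : partialJ j ∈ 𝓕 := by
    refine ⟨hJ j, ?_⟩
    rintro v ⟨i, hi, rfl | rfl⟩ <;> rw [vecMul_partialJ] <;> simp [hne j (by simp) i hi]
  have hFne : ∀ i ∈ F, i ≠ j := fun i hi h => hjF (h ▸ hi)
  -- The row of `x j` becomes a multiple of a basis vector; the multiple is a unit because the row
  -- has pairing `±1` with the row of `y j`, and a sign is removed by `partialJ j ^ 2`.
  obtain ⟨E₁, hE₁, h1, h1'⟩ := exists_kill_inr_finset (insert j F) hA' hL' (M (Sum.inl j))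
  obtain ⟨E₂, hE₂, h2, h2', h2''⟩ := exists_kill_inl_finset F hjF
    (fun i hi => hG' i (by simp [hi]) j (by simp) (hFne i hi))
    (fun i hi => hG' j (by simp) i (by simp [hi]) (hFne i hi).symm) (M (Sum.inl j) ᵥ* E₁) (by
      intro i
      by_cases hi : i ∈ insert j F
      · exact h1 i hi
      · rw [(h1' i hi).2, (vanish M hM hstd i hi).1.2])
  obtain ⟨E₃, hE₃, h3⟩ : ∃ E ∈ 𝓕, (M * E) (Sum.inl j) = Pi.single (Sum.inl j) 1 := by
    have hE₁₂ : E₁ * E₂ ∈ 𝓕 := mul_mem hE₁ hE₂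
    have hN : M * (E₁ * E₂) ∈ Matrix.symplecticGroup l ℤ := mul_mem hM (hSp hE₁₂.1)
    set c := (M * (E₁ * E₂)) (Sum.inl j) (Sum.inl j) with hc
    have hrow : (M * (E₁ * E₂)) (Sum.inl j) = Pi.single (Sum.inl j) c := by
      have hst := vanish _ hN (keep M _ hE₁₂.2 hstd)
      ext (i | i)
      · by_cases hij : i = j
        · subst hij; simp [hc]
        by_cases hi : i ∈ insert j F
        · have : i ∈ F := by simpa [hij] using hi
          simp [hij, row, ← vecMul_vecMul, h2 i this]
        · simp [hij, (hst i hi).1.1]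
      · simp [row, ← vecMul_vecMul, h2' i]
    have hunit := symplectic_row_pairing hN (Sum.inl j) (Sum.inr j)
    rw [hrow] at hunit
    simp [Pi.single_apply, Matrix.J] at hunit
    rcases Int.isUnit_iff.1 (IsUnit.of_mul_eq_one _ hunit) with h | h
    · exact ⟨_, hE₁₂, by rw [hrow, h]⟩
    · refine ⟨E₁ * E₂ * (partialJ j * partialJ j), mul_mem hE₁₂ (mul_mem hJ' hJ'), ?_⟩
      rw [← Matrix.mul_assoc, row, hrow, h, ← vecMul_vecMul, vecMul_partialJ, vecMul_partialJ]
      ext (i | i) <;> by_cases hij : i = j <;> simp [hij]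
  have hN₃ : M * E₃ ∈ Matrix.symplecticGroup l ℤ := mul_mem hM (hSp hE₃.1)
  -- The row of `y j` is cleared outside `j`, then its entry at `x j` is removed by `longRoot j`.
  set W : Set (l ⊕ l → ℤ) := {Pi.single (Sum.inl j) 1} with hW
  have hr : (M * E₃) (Sum.inr j) (Sum.inr j) = 1 := by
    have := symplectic_row_pairing hN₃ (Sum.inl j) (Sum.inr j)
    rw [h3] at this
    simpa [Pi.single_apply, Matrix.J] using this
  obtain ⟨E₄, hE₄, h4, h4', h4''⟩ := exists_clear_finset (𝓕 := 𝓕 ⊓ fixing W) F hjF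
    (fun i hi k => ⟨hG' j (by simp) i (by simp [hi]) (hFne i hi).symm k, by
      rintro v rfl; rw [vecMul_shear]; simp [hFne i hi]⟩)
    (fun i hi k => ⟨hS' i (by simp [hi]) j (by simp) (hFne i hi) k, by
      rintro v rfl; rw [vecMul_shortRoot]; simp⟩) _ hr
  have hE₃₄ : E₃ * E₄ ∈ 𝓕 := mul_mem hE₃ hE₄.1
  obtain ⟨N, hNdef⟩ : ∃ N, N = M * (E₃ * E₄) := ⟨_, rfl⟩
  have hN : N ∈ Matrix.symplecticGroup l ℤ := hNdef ▸ mul_mem hM (hSp hE₃₄.1)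
  have hNrow : N (Sum.inl j) = Pi.single (Sum.inl j) 1 := by
    rw [hNdef, ← Matrix.mul_assoc, row, h3, hE₄.2 _ rfl]
  have hst := keep M _ hE₃₄.2 hstd
  rw [← hNdef] at hst
  set E₅ := longRoot j (-(N (Sum.inr j) (Sum.inl j))) with hE₅
  refine ⟨E₃ * E₄ * E₅, mul_mem hE₃₄.1 (hA _ _), fun i hi => ?_⟩
  rw [← Matrix.mul_assoc, ← hNdef]
  by_cases hij : i = j
  · subst hij
    refine ⟨?_, ?_⟩
    · rw [row, hNrow, vecMul_longRoot]; simp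
    · rw [row, vecMul_longRoot]
      have hv : ∀ a ∉ insert i F, N (Sum.inr i) (Sum.inl a) = 0 ∧ N (Sum.inr i) (Sum.inr a) = 0 :=
        fun a ha => (vanish N hN hst a ha).2
      have hyi : N (Sum.inr i) (Sum.inr i) = 1 := by
        rw [hNdef, ← Matrix.mul_assoc, row]; exact h4
      have hF : ∀ a ∈ F, N (Sum.inr i) (Sum.inl a) = 0 ∧ N (Sum.inr i) (Sum.inr a) = 0 := by
        intro a ha
        rw [hNdef, ← Matrix.mul_assoc, row]; exact h4' a ha
      have hz : ∀ a, a ≠ i → N (Sum.inr i) (Sum.inl a) = 0 ∧ N (Sum.inr i) (Sum.inr a) = 0 := by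
        intro a hai
        by_cases ha : a ∈ F
        · exact hF a ha
        · exact hv a (by simp [hai, ha])
      ext (a | a) <;> by_cases hai : a = i
      · subst hai; simp [hyi]
      · simp [hai, hz a hai]
      · subst hai; simp [hyi]
      · simp [hai, hz a hai]
  · exact keep N E₅ (hA' j (by simp) _).2 hst i (by simp [hij, hi])

/-- The integral symplectic group is generated by long and short root elements of the unipotent
radical and by the partial inversions: each of its elements has an inverse in any submonoid that
contains these generators. -/
theorem exists_mul_eq_one_of_mem_symplecticGroup {𝓔 : Submonoid (Matrix (l ⊕ l) (l ⊕ l) ℤ)}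
    (hSp : 𝓔 ≤ Matrix.symplecticGroup l ℤ) (hA : ∀ i k, longRoot i k ∈ 𝓔)
    (hJ : ∀ i, partialJ i ∈ 𝓔) (hS : ∀ i j k, i ≠ j → shortRoot i j k ∈ 𝓔)
    {M : Matrix (l ⊕ l) (l ⊕ l) ℤ} (hM : M ∈ Matrix.symplecticGroup l ℤ) :
    ∃ E ∈ 𝓔, M * E = 1 := by
  suffices H : ∀ F : Finset l, ∀ M ∈ Matrix.symplecticGroup l ℤ,
      (∀ i ∉ F, M (Sum.inl i) = Pi.single (Sum.inl i) 1 ∧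
        M (Sum.inr i) = Pi.single (Sum.inr i) 1) → ∃ E ∈ 𝓔, M * E = 1 from
    H Finset.univ M hM (by simp)
  intro F
  induction F using Finset.induction_on with
  | empty =>
    intro M _ h
    refine ⟨1, one_mem _, ?_⟩
    ext (i | i) b
    · rw [mul_one, (h i (by simp)).1, Matrix.one_apply, Pi.single_apply]; simp [eq_comm]
    · rw [mul_one, (h i (by simp)).2, Matrix.one_apply, Pi.single_apply]; simp [eq_comm]
  | insert j F hj ih =>
    intro M hM h
    obtain ⟨E, hE, hst⟩ := exists_reduction_step hSp hA hJ hS F hj hM h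
    obtain ⟨E', hE', h'⟩ := ih (M * E) (mul_mem hM (hSp hE)) hst
    exact ⟨E * E', mul_mem hE hE', by rw [← Matrix.mul_assoc, h']⟩

end Generation

end Ciani

namespace Ciani

open Complex

/-! ### Theta series in one variable -/

section OneVariable

open scoped Real

/-- The theta series `∑ exp (π i (τ x² + x b))` over `x ∈ ℤ + a`. -/
noncomputable def thetaSum (τ a b : ℂ) : ℂ :=
  ∑' m : ℤ, cexp (π * I * (τ * (m + a) ^ 2 + (m + a) * b))

theorem thetaSum_term_eq (τ a b : ℂ) (m : ℤ) :
    cexp (π * I * (τ * (m + a) ^ 2 + (m + a) * b))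
      = cexp (π * I * (τ * a ^ 2 + a * b)) * jacobiTheta₂_term m (τ * a + b / 2) τ := by
  rw [jacobiTheta₂_term, ← Complex.exp_add]
  congr 1; ring

theorem summable_thetaSum {τ : ℂ} (hτ : 0 < τ.im) (a b : ℂ) :
    Summable fun m : ℤ => cexp (π * I * (τ * (m + a) ^ 2 + (m + a) * b)) := by
  simp_rw [thetaSum_term_eq]
  exact ((summable_jacobiTheta₂_term_iff _ _).2 hτ).mul_left _

theorem thetaSum_eq (τ a b : ℂ) :
    thetaSum τ a b
      = cexp (π * I * (τ * a ^ 2 + a * b)) * jacobiTheta₂ (τ * a + b / 2) τ := by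
  rw [thetaSum, jacobiTheta₂, ← tsum_mul_left]
  exact tsum_congr fun m => thetaSum_term_eq τ a b m

theorem thetaSum_add_one (τ a b : ℂ) : thetaSum τ (a + 1) b = thetaSum τ a b := by
  rw [thetaSum, thetaSum]
  conv_rhs => rw [← (Equiv.addRight (1 : ℤ)).tsum_eq]
  refine tsum_congr fun m => ?_
  simp only [Equiv.coe_addRight, Int.cast_add, Int.cast_one]
  congr 2; ring

theorem thetaSum_neg (τ a b : ℂ) : thetaSum τ (-a) (-b) = thetaSum τ a b := by
  rw [thetaSum, thetaSum, ← (Equiv.neg ℤ).tsum_eq]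
  refine tsum_congr fun m => ?_
  simp only [Equiv.neg_apply, Int.cast_neg]
  congr 2; ring

theorem thetaSum_add_two (τ a b : ℂ) :
    thetaSum τ a (b + 2) = cexp (2 * π * I * a) * thetaSum τ a b := by
  rw [thetaSum, thetaSum, ← tsum_mul_left]
  refine tsum_congr fun m => ?_
  rw [← Complex.exp_add, Complex.exp_eq_exp_iff_exists_int]
  exact ⟨m, by ring⟩

/-- The inversion formula, in the form which interchanges the two characteristics. -/
theorem thetaSum_functional_equation {τ : ℂ} (hτ : 0 < τ.im) (a b : ℂ) :
    thetaSum τ a b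
      = 1 / (-I * τ) ^ (1 / 2 : ℂ) * (cexp (π * I * (a * b)) *
          thetaSum (-1 / τ) (b / 2) (-2 * a)) := by
  have h0 : τ ≠ 0 := by rintro rfl; simp at hτ
  rw [thetaSum_eq, thetaSum_eq, jacobiTheta₂_functional_equation, ← jacobiTheta₂_neg_left]
  have e : -((τ * a + b / 2) / τ) = -1 / τ * (b / 2) + -2 * a / 2 := by field_simp; ring
  rw [e]
  have : cexp (π * I * (τ * a ^ 2 + a * b)) * cexp (-π * I * (τ * a + b / 2) ^ 2 / τ)
      = cexp (π * I * (a * b)) * cexp (π * I * (-1 / τ * (b / 2) ^ 2 + b / 2 * (-2 * a))) := by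
    rw [← Complex.exp_add, ← Complex.exp_add]
    congr 1; field_simp; ring
  linear_combination (1 / (-I * τ) ^ (1 / 2 : ℂ)) *
    jacobiTheta₂ (-1 / τ * (b / 2) + -2 * a / 2) (-1 / τ) * this

/-- The product formula for two theta series at `2τ`. The sums and differences of two elements of
`ℤ + a` and `ℤ + a'` form a sublattice of index two, which is cut out by a character. -/
theorem thetaSum_mul_thetaSum {τ : ℂ} (hτ : 0 < τ.im) (a a' b b' : ℂ) :
    thetaSum (2 * τ) a b * thetaSum (2 * τ) a' b'
      = 1 / 2 * (thetaSum τ (a + a') ((b + b') / 2) * thetaSum τ (a - a') ((b - b') / 2)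
        + cexp (-2 * π * I * a) * (thetaSum τ (a + a') ((b + b') / 2 + 1) *
            thetaSum τ (a - a') ((b - b') / 2 + 1))) := by
  have h2 : 0 < (2 * τ).im := by simpa using hτ
  have S := fun {t : ℂ} (ht : 0 < t.im) x y => (summable_thetaSum ht x y).norm
  simp only [thetaSum]
  rw [tsum_mul_tsum_of_summable_norm (S h2 a b) (S h2 a' b'),
    tsum_mul_tsum_of_summable_norm (S hτ (a + a') ((b + b') / 2)) (S hτ (a - a') ((b - b') / 2)),
    tsum_mul_tsum_of_summable_norm (S hτ (a + a') ((b + b') / 2 + 1))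
      (S hτ (a - a') ((b - b') / 2 + 1)), ← tsum_mul_left,
    ← (summable_mul_of_summable_norm (S hτ (a + a') ((b + b') / 2))
      (S hτ (a - a') ((b - b') / 2))).tsum_add
      ((summable_mul_of_summable_norm (S hτ (a + a') ((b + b') / 2 + 1))
      (S hτ (a - a') ((b - b') / 2 + 1))).mul_left _), ← tsum_mul_left]
  -- The right hand side sums over all pairs `(k, l)`; the factor `(1 + (-1)^(k + l)) / 2` retains
  -- those of the form `(m + n, m - n)`.
  set g : ℤ × ℤ → ℤ × ℤ := fun p => (p.1 + p.2, p.1 - p.2) with hg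
  have hinj : Function.Injective g := by
    rintro ⟨a, b⟩ ⟨c, d⟩ h
    simp only [hg, Prod.mk.injEq] at h
    ext <;> simp <;> omega
  have hterm : ∀ k l : ℤ, 1 / 2 * (cexp (π * I * (τ * (k + (a + a')) ^ 2 +
      (k + (a + a')) * ((b + b') / 2))) * cexp (π * I * (τ * (l + (a - a')) ^ 2 +
      (l + (a - a')) * ((b - b') / 2))) + cexp (-2 * π * I * a) *
      (cexp (π * I * (τ * (k + (a + a')) ^ 2 + (k + (a + a')) * ((b + b') / 2 + 1))) *
      cexp (π * I * (τ * (l + (a - a')) ^ 2 + (l + (a - a')) * ((b - b') / 2 + 1)))))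
      = (1 + (-1) ^ (k + l)) / 2 * cexp (π * I * (τ * (k + (a + a')) ^ 2 +
      (k + (a + a')) * ((b + b') / 2) + (τ * (l + (a - a')) ^ 2 +
      (l + (a - a')) * ((b - b') / 2)))) := by
    intro k l
    have h3 : ((-1 : ℂ)) ^ (k + l) = cexp (π * I * (k + l)) := by
      rw [← Complex.exp_pi_mul_I, ← Complex.exp_int_mul]; congr 1; push_cast; ring
    rw [h3]
    have e1 : cexp (π * I * (τ * (k + (a + a')) ^ 2 + (k + (a + a')) * ((b + b') / 2))) *
        cexp (π * I * (τ * (l + (a - a')) ^ 2 + (l + (a - a')) * ((b - b') / 2)))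
        = cexp (π * I * (τ * (k + (a + a')) ^ 2 + (k + (a + a')) * ((b + b') / 2) +
          (τ * (l + (a - a')) ^ 2 + (l + (a - a')) * ((b - b') / 2)))) := by
      rw [← Complex.exp_add]; congr 1; ring
    have e2 : cexp (-2 * π * I * a) *
        (cexp (π * I * (τ * (k + (a + a')) ^ 2 + (k + (a + a')) * ((b + b') / 2 + 1))) *
        cexp (π * I * (τ * (l + (a - a')) ^ 2 + (l + (a - a')) * ((b - b') / 2 + 1))))
        = cexp (π * I * (k + l)) * cexp (π * I * (τ * (k + (a + a')) ^ 2 +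
          (k + (a + a')) * ((b + b') / 2) +
          (τ * (l + (a - a')) ^ 2 + (l + (a - a')) * ((b - b') / 2)))) := by
      rw [← Complex.exp_add, ← Complex.exp_add, ← Complex.exp_add]; congr 1; ring
    rw [e1, e2]; ring
  refine Eq.trans ?_ (hinj.tsum_eq ?_)
  · refine tsum_congr fun p => ?_
    rw [hterm]
    have : ((-1 : ℂ)) ^ ((g p).1 + (g p).2) = 1 := by
      have : (g p).1 + (g p).2 = 2 * p.1 := by simp only [hg]; ring
      rw [this, zpow_mul]; simp
    rw [this, ← Complex.exp_add]
    simp only [hg]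
    push_cast
    rw [show ((1 : ℂ) + 1) / 2 = 1 by norm_num, one_mul]
    congr 1; ring
  · rintro ⟨k, l⟩ hp
    rw [Function.mem_support] at hp
    rw [hterm] at hp
    rcases Int.even_or_odd (k + l) with h | h
    · obtain ⟨c, hc⟩ := h
      exact ⟨(c, k - c), by simp only [hg, Prod.mk.injEq]; omega⟩
    · rw [h.neg_one_zpow] at hp; simp at hp

/-- The odd theta constant vanishes. -/
theorem thetaSum_half_one (τ : ℂ) : thetaSum τ (1 / 2) 1 = 0 := by
  have h1 := thetaSum_neg τ (1 / 2) 1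
  have h2 := thetaSum_add_one τ (-(1 / 2)) (-1)
  have h3 := thetaSum_add_two τ (1 / 2) (-1)
  rw [show -(1 / 2 : ℂ) + 1 = 1 / 2 by ring] at h2
  rw [show (-1 : ℂ) + 2 = 1 by ring, show 2 * π * I * (1 / 2) = π * I by ring,
    Complex.exp_pi_mul_I] at h3
  linear_combination (1 / 2) * h3 - (1 / 2) * h1 - (1 / 2) * h2

/-- The theta constant `θ₂ = ∑ exp (π i τ (m + 1/2)²)`, with characteristic `[1; 0]`. -/
noncomputable def θ₂ (τ : ℂ) : ℂ := thetaSum τ (1 / 2) 0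

/-- The theta constant `θ₃ = ∑ exp (π i τ m²)`, with characteristic `[0; 0]`. -/
noncomputable def θ₃ (τ : ℂ) : ℂ := thetaSum τ 0 0

/-- The theta constant `θ₄ = ∑ (-1)^m exp (π i τ m²)`, with characteristic `[0; 1]`. -/
noncomputable def θ₄ (τ : ℂ) : ℂ := thetaSum τ 0 1

theorem thetaSum_zero_two (τ : ℂ) : thetaSum τ 0 2 = θ₃ τ := by
  have := thetaSum_add_two τ 0 0
  simpa [θ₃] using this

theorem thetaSum_zero_neg_one (τ : ℂ) : thetaSum τ 0 (-1) = θ₄ τ := by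
  have := thetaSum_neg τ 0 1
  simpa [θ₄] using this

theorem thetaSum_one_zero (τ : ℂ) : thetaSum τ 1 0 = θ₃ τ := by
  have := thetaSum_add_one τ 0 0
  simpa [θ₃] using this

theorem thetaSum_one_one (τ : ℂ) : thetaSum τ 1 1 = θ₄ τ := by
  have := thetaSum_add_one τ 0 1
  simpa [θ₄] using this

theorem thetaSum_half_two (τ : ℂ) : thetaSum τ (1 / 2) 2 = -θ₂ τ := by
  have := thetaSum_add_two τ (1 / 2) 0
  rw [zero_add, show 2 * π * I * (1 / 2) = π * I by ring, Complex.exp_pi_mul_I] at this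
  simpa [θ₂] using this

theorem θ₃_two_mul_sq {τ : ℂ} (hτ : 0 < τ.im) :
    θ₃ (2 * τ) ^ 2 = (θ₃ τ ^ 2 + θ₄ τ ^ 2) / 2 := by
  have h := thetaSum_mul_thetaSum hτ 0 0 0 0
  simp only [add_zero, sub_zero, zero_div, mul_zero, Complex.exp_zero, zero_add, one_mul] at h
  rw [θ₃, θ₃, θ₄]
  linear_combination h

theorem θ₂_two_mul_sq {τ : ℂ} (hτ : 0 < τ.im) :
    θ₂ (2 * τ) ^ 2 = (θ₃ τ ^ 2 - θ₄ τ ^ 2) / 2 := by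
  have h := thetaSum_mul_thetaSum hτ (1 / 2) (1 / 2) 0 0
  simp only [add_zero, sub_self, zero_div, zero_add] at h
  rw [show (1 / 2 + 1 / 2 : ℂ) = 1 by norm_num, thetaSum_one_zero, thetaSum_one_one,
    show -2 * π * I * (1 / 2) = -(π * I) by ring, Complex.exp_neg, Complex.exp_pi_mul_I] at h
  rw [θ₂]
  simp only [θ₃, θ₄] at h ⊢
  linear_combination h

theorem θ₄_two_mul_sq {τ : ℂ} (hτ : 0 < τ.im) : θ₄ (2 * τ) ^ 2 = θ₃ τ * θ₄ τ := by
  have h := thetaSum_mul_thetaSum hτ 0 0 1 1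
  rw [show ((1 : ℂ) + 1) / 2 = 1 by norm_num, show (1 : ℂ) + 1 = 2 by norm_num] at h
  simp only [add_zero, sub_self, zero_div, mul_zero, Complex.exp_zero, zero_add, one_mul,
    thetaSum_zero_two] at h
  rw [θ₄]
  simp only [θ₃, θ₄] at h ⊢
  linear_combination h

theorem θ₂_mul_θ₃_two_mul {τ : ℂ} (hτ : 0 < τ.im) :
    θ₂ (2 * τ) * θ₃ (2 * τ) = θ₂ τ ^ 2 / 2 := by
  have h := thetaSum_mul_thetaSum hτ (1 / 2) 0 0 0
  simp only [add_zero, sub_zero, zero_div, zero_add, thetaSum_half_one] at h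
  simp only [θ₂, θ₃]
  linear_combination h

theorem thetaSum_quarter_zero_sq {τ : ℂ} (hτ : 0 < τ.im) :
    thetaSum (2 * τ) (1 / 4) 0 ^ 2 = θ₂ τ * θ₃ τ / 2 := by
  have h := thetaSum_mul_thetaSum hτ (1 / 4) (1 / 4) 0 0
  rw [show (1 / 4 : ℂ) + 1 / 4 = 1 / 2 by norm_num] at h
  simp only [add_zero, sub_self, zero_div, zero_add, thetaSum_half_one] at h
  simp only [θ₂, θ₃]
  linear_combination h

theorem exp_neg_two_pi_I_quarter : cexp (-2 * π * I * (1 / 4)) = -I := by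
  rw [show -2 * π * I * (1 / 4) = -(π / 2 * I) by ring, Complex.exp_neg,
    Complex.exp_pi_div_two_mul_I]
  simp

theorem thetaSum_quarter_one_sq {τ : ℂ} (hτ : 0 < τ.im) :
    thetaSum (2 * τ) (1 / 4) 1 ^ 2 = I * (θ₂ τ * θ₄ τ) / 2 := by
  have h := thetaSum_mul_thetaSum hτ (1 / 4) (1 / 4) 1 1
  rw [show (1 / 4 : ℂ) + 1 / 4 = 1 / 2 by norm_num, show ((1 : ℂ) + 1) / 2 = 1 by norm_num,
    show (1 : ℂ) + 1 = 2 by norm_num, exp_neg_two_pi_I_quarter, thetaSum_half_two] at h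
  simp only [sub_self, zero_div, zero_add, thetaSum_half_one] at h
  simp only [θ₂, θ₄] at h ⊢
  linear_combination h

/-- Jacobi's identity, as a consequence of
`4 θ₂(2τ)² θ₃(2τ)² = (θ₃(τ)² - θ₄(τ)²) (θ₃(τ)² + θ₄(τ)²)`. -/
theorem θ₃_pow_four {τ : ℂ} (hτ : 0 < τ.im) : θ₃ τ ^ 4 = θ₂ τ ^ 4 + θ₄ τ ^ 4 := by
  linear_combination 4 * (θ₂ (2 * τ) * θ₃ (2 * τ) + θ₂ τ ^ 2 / 2) * θ₂_mul_θ₃_two_mul hτ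
    - 4 * θ₂ (2 * τ) ^ 2 * θ₃_two_mul_sq hτ - 2 * (θ₃ τ ^ 2 + θ₄ τ ^ 2) * θ₂_two_mul_sq hτ

theorem θ₄_eq_jacobiTheta (τ : ℂ) : θ₄ τ = jacobiTheta (τ + 1) := by
  rw [θ₄, thetaSum, jacobiTheta]
  refine tsum_congr fun m => ?_
  rw [Complex.exp_eq_exp_iff_exists_int]
  obtain ⟨k', hk'⟩ : Even (m * (m - 1)) := Int.even_mul_pred_self m
  refine ⟨-k', ?_⟩
  have : (m : ℂ) * (m - 1) = k' + k' := by exact_mod_cast hk'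
  push_cast
  linear_combination (-(π : ℂ) * I) * this

/-- Far up in the upper half plane the term `1` of `θ₄` dominates the others. -/
theorem θ₄_ne_zero_of_one_le {τ : ℂ} (hτ : 1 ≤ τ.im) : θ₄ τ ≠ 0 := by
  intro h
  have h1 := norm_jacobiTheta_sub_one_le (τ := τ + 1) (by simp; linarith)
  rw [← θ₄_eq_jacobiTheta, h] at h1
  have him : (τ + 1).im = τ.im := by simp
  rw [him] at h1
  -- With `t = exp (-π Im τ)`, the bound `2 t / (1 - t)` for `|θ₄ - 1|` is below `1` if `t < 1 / 3`.
  have h2 : rexp (-π * τ.im) < 1 / 3 := by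
    have : rexp (-π * τ.im) ≤ rexp (-2) := by
      apply Real.exp_le_exp.2
      nlinarith [Real.pi_gt_three]
    have h4 : rexp (-2) = (rexp 1 * rexp 1)⁻¹ := by
      rw [← Real.exp_add, ← Real.exp_neg]; norm_num
    have h3 := Real.exp_one_gt_d9
    have : (rexp 1 * rexp 1)⁻¹ < 1 / 3 := by
      rw [inv_lt_comm₀ (by positivity) (by norm_num)]
      nlinarith
    linarith
  have h0 := Real.exp_pos (-π * τ.im)
  simp only [zero_sub, norm_neg, norm_one] at h1
  rw [div_mul_eq_mul_div, le_div_iff₀ (by linarith)] at h1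
  linarith

/-- If `θ₄` vanished at `τ`, then it would vanish at all `2ⁿτ`, since `θ₄(2τ)² = θ₃(τ) θ₄(τ)`. -/
theorem θ₄_ne_zero {τ : ℂ} (hτ : 0 < τ.im) : θ₄ τ ≠ 0 := by
  obtain ⟨n, hn⟩ := pow_unbounded_of_one_lt (τ.im)⁻¹ (one_lt_two : (1 : ℝ) < 2)
  have hn' : 1 ≤ 2 ^ n * τ.im := by
    rw [inv_lt_iff_one_lt_mul₀ hτ] at hn; linarith
  clear hn
  induction n generalizing τ with
  | zero => exact θ₄_ne_zero_of_one_le (by simpa using hn')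
  | succ n ih =>
    have := ih (τ := 2 * τ) (by simpa using hτ) (by simp; rw [pow_succ] at hn'; linarith)
    intro h
    have h2 := θ₄_two_mul_sq hτ
    rw [h, mul_zero] at h2
    exact this (pow_eq_zero_iff (two_ne_zero) |>.1 h2)

theorem θ₃_ne_zero {τ : ℂ} (hτ : 0 < τ.im) : θ₃ τ ≠ 0 := by
  intro h
  have h2 := θ₄_two_mul_sq hτ
  rw [h, zero_mul] at h2
  exact θ₄_ne_zero (τ := 2 * τ) (by simpa using hτ) (pow_eq_zero_iff (two_ne_zero) |>.1 h2)

theorem im_neg_one_div_pos {τ : ℂ} (hτ : 0 < τ.im) : 0 < (-1 / τ).im := by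
  have h0 : τ ≠ 0 := by rintro rfl; simp at hτ
  rw [neg_div, one_div, Complex.neg_im, Complex.inv_im, neg_div, neg_neg]
  exact div_pos hτ (Complex.normSq_pos.2 h0)

theorem θ₂_ne_zero {τ : ℂ} (hτ : 0 < τ.im) : θ₂ τ ≠ 0 := by
  have h0 : τ ≠ 0 := by rintro rfl; simp at hτ
  rw [θ₂, thetaSum_functional_equation hτ]
  rw [zero_div, show (-2 * (1 / 2) : ℂ) = -1 by norm_num, thetaSum_zero_neg_one]
  refine mul_ne_zero (one_div_ne_zero ?_) (mul_ne_zero (Complex.exp_ne_zero _)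
    (θ₄_ne_zero (im_neg_one_div_pos hτ)))
  rw [Ne, Complex.cpow_eq_zero_iff]
  simp [h0]

end OneVariable

end Ciani

namespace Ciani

open Complex Matrix

/-! ### Convergence of theta series in several variables -/

section SeveralVariables

open scoped Real

/-- The Siegel upper half space: symmetric matrices with positive definite imaginary part. -/
def IsSiegel {g : ℕ} (τ : Matrix (Fin g) (Fin g) ℂ) : Prop :=
  τ.IsSymm ∧ (τ.map Complex.im).PosDef

/-- The product formula for series over `ℤ^g`. -/
theorem tsum_pi_prod {g : ℕ} (f : Fin g → ℤ → ℂ) (hf : ∀ i, Summable fun n => ‖f i n‖) :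
    (Summable fun n : Fin g → ℤ => ‖∏ i, f i (n i)‖) ∧
      ∑' n : Fin g → ℤ, ∏ i, f i (n i) = ∏ i, ∑' n, f i n := by
  induction g with
  | zero => exact ⟨(hasSum_fintype _).summable, by simp⟩
  | succ g ih =>
    obtain ⟨h1, h2⟩ := ih (fun i => f i.succ) fun i => hf i.succ
    set e := Fin.consEquiv (fun _ : Fin (g + 1) => ℤ)
    have he : ∀ p : ℤ × (Fin g → ℤ), ∏ i, f i (e p i) = f 0 p.1 * ∏ i, f i.succ (p.2 i) := by
      intro p
      rw [Fin.prod_univ_succ]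
      simp [e, Fin.consEquiv]
    constructor
    · rw [← e.summable_iff]
      refine (summable_mul_of_summable_norm (hf 0) h1).norm.congr fun p => ?_
      rw [Function.comp_apply, he]
    · rw [← e.tsum_eq, Fin.prod_univ_succ, ← h2, tsum_mul_tsum_of_summable_norm (hf 0) h1]
      exact tsum_congr he

theorem exists_mul_sum_sq_le_of_posDef {g : ℕ} {Y : Matrix (Fin g) (Fin g) ℝ} (hY : Y.PosDef) :
    ∃ c > 0, ∀ x : Fin g → ℝ, c * ∑ i, x i ^ 2 ≤ x ⬝ᵥ Y *ᵥ x := by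
  have hcont : Continuous fun x : Fin g → ℝ => x ⬝ᵥ Y *ᵥ x := by fun_prop
  obtain ⟨m, hm, hmin⟩ := (isCompact_sphere (0 : Fin g → ℝ) 1).exists_forall_le' (a := 0)
    hcont.continuousOn fun x hx => by
      have hx0 : x ≠ 0 := by rintro rfl; simp at hx
      simpa using hY.dotProduct_mulVec_pos hx0
  refine ⟨m / (g + 1), by positivity, fun x => ?_⟩
  by_cases hx : x = 0
  · subst hx; simp
  have hn : 0 < ‖x‖ := norm_pos_iff.2 hx
  have h1 := hmin (‖x‖⁻¹ • x) (by simp [norm_smul, hn.ne'])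
  rw [mulVec_smul, smul_dotProduct, dotProduct_smul, smul_eq_mul, smul_eq_mul] at h1
  have h2 : m * ‖x‖ ^ 2 ≤ x ⬝ᵥ Y *ᵥ x := by
    have := mul_le_mul_of_nonneg_left h1 (sq_nonneg ‖x‖)
    calc m * ‖x‖ ^ 2 = ‖x‖ ^ 2 * m := by ring
      _ ≤ _ := this
      _ = _ := by field_simp
  have h3 : ∑ i, x i ^ 2 ≤ (g + 1) * ‖x‖ ^ 2 := by
    calc ∑ i, x i ^ 2 ≤ ∑ _i : Fin g, ‖x‖ ^ 2 := by
          refine Finset.sum_le_sum fun i _ => ?_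
          have := norm_le_pi_norm x i
          rw [Real.norm_eq_abs] at this
          rw [← sq_abs]; gcongr
      _ = g * ‖x‖ ^ 2 := by simp
      _ ≤ _ := by nlinarith [sq_nonneg ‖x‖]
  calc m / (g + 1) * ∑ i, x i ^ 2 ≤ m / (g + 1) * ((g + 1) * ‖x‖ ^ 2) := by gcongr
    _ = m * ‖x‖ ^ 2 := by field_simp
    _ ≤ _ := h2

/-- The general term of a theta series, as a function of the point `x` of the shifted lattice. -/
noncomputable def thetaTerm {g : ℕ} (τ : Matrix (Fin g) (Fin g) ℂ) (b x : Fin g → ℂ) : ℂ :=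
  cexp (π * I * (x ⬝ᵥ τ *ᵥ x + x ⬝ᵥ b))

theorem thetaNull_eq {g : ℕ} (ε₁ ε₂ : Fin g → ℤ) (τ : Matrix (Fin g) (Fin g) ℂ) :
    thetaNull ε₁ ε₂ τ = ∑' n : Fin g → ℤ,
      thetaTerm τ (fun i => (ε₂ i : ℂ)) (fun i => (n i : ℂ) + (ε₁ i : ℂ) / 2) := by
  rw [thetaNull, theta]
  refine tsum_congr fun n => ?_
  rw [thetaTerm]
  congr 3
  simp only [dotProduct, Finset.mul_sum, Pi.zero_apply]
  exact Finset.sum_congr rfl fun i _ => by ring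

theorem norm_thetaTerm_ofReal {g : ℕ} (τ : Matrix (Fin g) (Fin g) ℂ) (b x : Fin g → ℝ) :
    ‖thetaTerm τ (fun i => (b i : ℂ)) (fun i => (x i : ℂ))‖
      = rexp (-π * (x ⬝ᵥ (τ.map Complex.im) *ᵥ x)) := by
  rw [thetaTerm, Complex.norm_exp]
  congr 1
  have h1 : ((fun i => (x i : ℂ)) ⬝ᵥ fun i => (b i : ℂ)).im = 0 := by
    simp [dotProduct]
  have h2 : ((fun i => (x i : ℂ)) ⬝ᵥ τ *ᵥ fun i => (x i : ℂ)).im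
      = x ⬝ᵥ (τ.map Complex.im) *ᵥ x := by
    simp [dotProduct, mulVec]
  have h3 : ∀ z : ℂ, (π * I * z).re = -π * z.im := by intro z; simp
  rw [h3, Complex.add_im, h1, h2, add_zero]

/-- The series is dominated by a product of theta series in one variable with parameter `c * I`,
where `c` is a lower bound for the imaginary part of `τ`. -/
theorem summable_thetaTerm {g : ℕ} {τ : Matrix (Fin g) (Fin g) ℂ} (hτ : IsSiegel τ)
    (ε₁ ε₂ : Fin g → ℤ) :
    Summable fun n : Fin g → ℤ =>
      thetaTerm τ (fun i => (ε₂ i : ℂ)) (fun i => (n i : ℂ) + (ε₁ i : ℂ) / 2) := by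
  obtain ⟨c, hc, hle⟩ := exists_mul_sum_sq_le_of_posDef hτ.2
  have hs : ∀ i : Fin g, Summable fun n : ℤ =>
      ‖cexp (π * I * ((c * I : ℂ) * (n + (ε₁ i : ℂ) / 2) ^ 2 + (n + (ε₁ i : ℂ) / 2) * 0))‖ :=
    fun i => (summable_thetaSum (by simpa using hc) _ _).norm
  refine (tsum_pi_prod _ hs).1.of_norm_bounded fun n => ?_
  have := norm_thetaTerm_ofReal τ (fun i => (ε₂ i : ℝ)) (fun i => (n i : ℝ) + (ε₁ i : ℝ) / 2)
  push_cast at this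
  rw [this, norm_prod]
  have h : ∀ i, ‖cexp (π * I * ((c * I : ℂ) * (n i + (ε₁ i : ℂ) / 2) ^ 2 +
      (n i + (ε₁ i : ℂ) / 2) * 0))‖ = rexp (-π * (c * ((n i : ℝ) + (ε₁ i : ℝ) / 2) ^ 2)) := by
    intro i
    rw [Complex.norm_exp]
    congr 1
    have : (π * I * ((c * I : ℂ) * (n i + (ε₁ i : ℂ) / 2) ^ 2 +
      (n i + (ε₁ i : ℂ) / 2) * 0)) = ((-π * (c * ((n i : ℝ) + (ε₁ i : ℝ) / 2) ^ 2) : ℝ) : ℂ) := by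
      push_cast
      linear_combination (π * c * (n i + (ε₁ i : ℂ) / 2) ^ 2 : ℂ) * I_mul_I
    rw [this, Complex.ofReal_re]
  simp_rw [h]
  rw [← Real.exp_sum, Real.exp_le_exp, ← Finset.mul_sum, ← Finset.mul_sum]
  have := hle fun i => (n i : ℝ) + (ε₁ i : ℝ) / 2
  nlinarith [Real.pi_pos]

/-! ### Transformation of theta constants under generators -/

theorem thetaNull_add_two_mul {g : ℕ} (ε₁ ε₂ b : Fin g → ℤ) (τ : Matrix (Fin g) (Fin g) ℂ) :
    thetaNull ε₁ (fun i => ε₂ i + 2 * b i) τ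
      = cexp (π * I * ∑ i, (ε₁ i * b i : ℂ)) * thetaNull ε₁ ε₂ τ := by
  rw [thetaNull_eq, thetaNull_eq, ← tsum_mul_left]
  refine tsum_congr fun n => ?_
  rw [thetaTerm, thetaTerm, ← Complex.exp_add, Complex.exp_eq_exp_iff_exists_int]
  refine ⟨∑ i, n i * b i, ?_⟩
  have : (fun i => (n i : ℂ) + (ε₁ i : ℂ) / 2) ⬝ᵥ (fun i => ((ε₂ i + 2 * b i : ℤ) : ℂ))
      = ∑ i, (ε₁ i * b i : ℂ) +
        (fun i => (n i : ℂ) + (ε₁ i : ℂ) / 2) ⬝ᵥ (fun i => (ε₂ i : ℂ))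
        + 2 * ∑ i, (n i * b i : ℂ) := by
    simp only [dotProduct, Finset.mul_sum, ← Finset.sum_add_distrib]
    refine Finset.sum_congr rfl fun i _ => ?_
    push_cast; ring
  rw [this]
  push_cast
  ring

theorem dotProduct_single_mulVec {g : ℕ} (x : Fin g → ℂ) (i j : Fin g) :
    x ⬝ᵥ (Matrix.single i j (1 : ℂ)) *ᵥ x = x i * x j := by
  simp [Matrix.single_mulVec, dotProduct, Function.update_apply]

/-- Translation of `τ` by the diagonal matrix unit at `i`: since `n (n - 1)` is even, `x i ^ 2` is,
up to even integers, affine in `x i = n i + ε₁ i / 2`. -/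
theorem thetaNull_add_single {g : ℕ} (ε₁ ε₂ : Fin g → ℤ) (τ : Matrix (Fin g) (Fin g) ℂ)
    (i : Fin g) :
    thetaNull ε₁ ε₂ (τ + Matrix.single i i 1)
      = cexp (π * I * (3 * (ε₁ i : ℂ) ^ 2 / 4 - ε₁ i / 2)) *
        thetaNull ε₁ (fun k => ε₂ k + if k = i then 1 - ε₁ i else 0) τ := by
  rw [thetaNull_eq, thetaNull_eq, ← tsum_mul_left]
  refine tsum_congr fun n => ?_
  rw [thetaTerm, thetaTerm, ← Complex.exp_add, Complex.exp_eq_exp_iff_exists_int]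
  obtain ⟨c, hc⟩ := Int.even_mul_pred_self (n i)
  refine ⟨c + n i * ε₁ i, ?_⟩
  have hc' : (n i : ℂ) * (n i - 1) = c + c := by exact_mod_cast hc
  generalize hx : (fun k => (n k : ℂ) + (ε₁ k : ℂ) / 2) = x
  have hxi : x i = (n i : ℂ) + (ε₁ i : ℂ) / 2 := by rw [← hx]
  have h1 : x ⬝ᵥ (τ + Matrix.single i i 1) *ᵥ x = x ⬝ᵥ τ *ᵥ x + x i ^ 2 := by
    rw [add_mulVec, dotProduct_add, dotProduct_single_mulVec, sq]
  have h2 : x ⬝ᵥ (fun k => ((ε₂ k + if k = i then 1 - ε₁ i else 0 : ℤ) : ℂ))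
      = x ⬝ᵥ (fun k => (ε₂ k : ℂ)) + x i * (1 - ε₁ i) := by
    simp [dotProduct, mul_add, Finset.sum_add_distrib]
  rw [h1, h2, hxi]
  push_cast
  linear_combination (π * I : ℂ) * hc'

/-- Translation of `τ` by a symmetrized off-diagonal matrix unit: up to even integers,
`2 * x i * x j` is affine in `x i` and `x j`. -/
theorem thetaNull_add_single_add_single {g : ℕ} (ε₁ ε₂ : Fin g → ℤ)
    (τ : Matrix (Fin g) (Fin g) ℂ) {i j : Fin g} :
    thetaNull ε₁ ε₂ (τ + (Matrix.single i j 1 + Matrix.single j i 1))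
      = cexp (-(π * I * (ε₁ i * ε₁ j / 2))) *
        thetaNull ε₁ (fun k => ε₂ k + ((if k = i then ε₁ j else 0) +
          if k = j then ε₁ i else 0)) τ := by
  rw [thetaNull_eq, thetaNull_eq, ← tsum_mul_left]
  refine tsum_congr fun n => ?_
  rw [thetaTerm, thetaTerm, ← Complex.exp_add, Complex.exp_eq_exp_iff_exists_int]
  refine ⟨n i * n j, ?_⟩
  generalize hx : (fun k => (n k : ℂ) + (ε₁ k : ℂ) / 2) = x
  have hxi : x i = (n i : ℂ) + (ε₁ i : ℂ) / 2 := by rw [← hx]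
  have hxj : x j = (n j : ℂ) + (ε₁ j : ℂ) / 2 := by rw [← hx]
  have h1 : x ⬝ᵥ (τ + (Matrix.single i j 1 + Matrix.single j i 1)) *ᵥ x
      = x ⬝ᵥ τ *ᵥ x + 2 * (x i * x j) := by
    rw [add_mulVec, add_mulVec, dotProduct_add, dotProduct_add, dotProduct_single_mulVec,
      dotProduct_single_mulVec]
    ring
  have h2 : x ⬝ᵥ (fun k => ((ε₂ k + ((if k = i then ε₁ j else 0) +
          if k = j then ε₁ i else 0) : ℤ) : ℂ))
      = x ⬝ᵥ (fun k => (ε₂ k : ℂ)) + (x i * ε₁ j + x j * ε₁ i) := by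
    simp [dotProduct, mul_add, Finset.sum_add_distrib]
  rw [h1, h2, hxi, hxj]
  push_cast
  ring

/-- Expansion of the quadratic form of `τ` in the `i`-th coordinate. -/
theorem dotProduct_mulVec_insertNth {g : ℕ} {τ : Matrix (Fin (g + 1)) (Fin (g + 1)) ℂ}
    (hτ : τ.IsSymm) (i : Fin (g + 1)) (t : ℂ) (u : Fin g → ℂ) :
    (i.insertNth t u : Fin (g + 1) → ℂ) ⬝ᵥ τ *ᵥ (i.insertNth t u : Fin (g + 1) → ℂ)
      = τ i i * t ^ 2 + 2 * t * (∑ j, τ i (i.succAbove j) * u j)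
        + u ⬝ᵥ (τ.submatrix i.succAbove i.succAbove) *ᵥ u := by
  have hs : ∀ j, τ (i.succAbove j) i = τ i (i.succAbove j) := fun j => hτ.apply _ _
  simp only [dotProduct, mulVec, Fin.sum_univ_succAbove _ i, Fin.insertNth_apply_same,
    Fin.insertNth_apply_succAbove, submatrix_apply, hs, mul_add, Finset.sum_add_distrib]
  have : ∑ x, u x * (τ i (i.succAbove x) * t) = t * ∑ x, τ i (i.succAbove x) * u x := by
    rw [Finset.mul_sum]; exact Finset.sum_congr rfl fun _ _ => by ring
  rw [this]
  ring

/-- The partial inversion of `τ` at the index `i`: for `g = 1` it is `-1 / τ`, and in general the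
action on the Siegel space of the symplectic matrix that is `[0 -1; 1 0]` at the index `i` and the
identity elsewhere. -/
noncomputable def partialInv {g : ℕ} (τ : Matrix (Fin g) (Fin g) ℂ) (i : Fin g) :
    Matrix (Fin g) (Fin g) ℂ :=
  Matrix.of fun j k =>
    if j = i then (if k = i then -1 / τ i i else -τ i k / τ i i)
    else (if k = i then -τ j i / τ i i else τ j k - τ j i * τ i k / τ i i)

theorem IsSiegel.im_diag_pos {g : ℕ} {τ : Matrix (Fin g) (Fin g) ℂ} (hτ : IsSiegel τ)
    (i : Fin g) : 0 < (τ i i).im := by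
  simpa using hτ.2.diag_pos (i := i)

/-- Summation over the `i`-th coordinate first. -/
theorem tsum_eq_tsum_tsum_insertNth {g : ℕ} (i : Fin (g + 1)) {f : (Fin (g + 1) → ℤ) → ℂ}
    (hf : Summable f) :
    ∑' n, f n = ∑' v : Fin g → ℤ, ∑' k : ℤ, f (i.insertNth k v) := by
  set e := (Equiv.prodComm (Fin g → ℤ) ℤ).trans (Fin.insertNthEquiv (fun _ => ℤ) i)
  rw [← e.tsum_eq]
  exact Summable.tsum_prod (e.summable_iff.2 hf)

/-- The functional equation of theta constants under partial inversion: Poisson summation in one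
of the coordinates. -/
theorem thetaNull_partialInv {g : ℕ} {τ : Matrix (Fin (g + 1)) (Fin (g + 1)) ℂ} (i : Fin (g + 1))
    (hτ : IsSiegel τ) (hτ' : IsSiegel (partialInv τ i)) (ε₁ ε₂ : Fin (g + 1) → ℤ) :
    thetaNull ε₁ ε₂ τ
      = 1 / (-I * τ i i) ^ (1 / 2 : ℂ) * (cexp (π * I * (ε₁ i * ε₂ i / 2)) *
        thetaNull (Function.update ε₁ i (ε₂ i)) (Function.update ε₂ i (-ε₁ i))
          (partialInv τ i)) := by
  have him := hτ.im_diag_pos i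
  have h0 : τ i i ≠ 0 := by intro h; rw [h] at him; simp at him
  rw [thetaNull_eq, thetaNull_eq, tsum_eq_tsum_tsum_insertNth i (summable_thetaTerm hτ _ _),
    tsum_eq_tsum_tsum_insertNth i (summable_thetaTerm hτ' _ _), ← tsum_mul_left, ← tsum_mul_left]
  refine tsum_congr fun v => ?_
  set u : Fin g → ℂ := fun j => (v j : ℂ) + (ε₁ (i.succAbove j) : ℂ) / 2 with hu
  set w := ∑ j, τ i (i.succAbove j) * u j with hw
  set q := u ⬝ᵥ (τ.submatrix i.succAbove i.succAbove) *ᵥ u with hq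
  set L := ∑ j, u j * ε₂ (i.succAbove j) with hL
  have hx : ∀ k : ℤ, (fun j => ((i.insertNth k v : Fin (g + 1) → ℤ) j : ℂ) + (ε₁ j : ℂ) / 2)
      = (i.insertNth ((k : ℂ) + ε₁ i / 2) u : Fin (g + 1) → ℂ) := by
    intro k
    rw [funext_iff, Fin.forall_iff_succAbove i]
    simp [hu]
  have hx' : ∀ k : ℤ, (fun j => ((i.insertNth k v : Fin (g + 1) → ℤ) j : ℂ) +
      ((Function.update ε₁ i (ε₂ i) j : ℤ) : ℂ) / 2)
      = (i.insertNth ((k : ℂ) + ε₂ i / 2) u : Fin (g + 1) → ℂ) := by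
    intro k
    rw [funext_iff, Fin.forall_iff_succAbove i]
    simp [hu]
  have hw' : ∑ j, partialInv τ i i (i.succAbove j) * u j = -w / τ i i := by
    rw [hw, ← Finset.sum_neg_distrib, Finset.sum_div]
    exact Finset.sum_congr rfl fun j _ => by simp [partialInv]; ring
  have hq' : u ⬝ᵥ ((partialInv τ i).submatrix i.succAbove i.succAbove) *ᵥ u
      = q - w ^ 2 / τ i i := by
    have hs : ∀ j, τ (i.succAbove j) i = τ i (i.succAbove j) := fun j => hτ.1.apply _ _
    simp only [hq, hw, dotProduct, mulVec, submatrix_apply, partialInv, of_apply,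
      Fin.succAbove_ne, if_false, hs]
    rw [sq, Finset.sum_mul_sum, Finset.sum_div, ← Finset.sum_sub_distrib]
    refine Finset.sum_congr rfl fun j _ => ?_
    rw [Finset.mul_sum, Finset.mul_sum, Finset.sum_div, ← Finset.sum_sub_distrib]
    exact Finset.sum_congr rfl fun k _ => by ring
  -- For fixed values `v` of the other coordinates, both sides are theta series in one variable.
  have e1 : ∑' k : ℤ, thetaTerm τ (fun j => (ε₂ j : ℂ))
      (fun j => ((i.insertNth k v : Fin (g + 1) → ℤ) j : ℂ) + (ε₁ j : ℂ) / 2)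
      = cexp (π * I * (q + L)) * thetaSum (τ i i) (ε₁ i / 2) (2 * w + ε₂ i) := by
    rw [thetaSum, ← tsum_mul_left]
    refine tsum_congr fun k => ?_
    rw [hx, thetaTerm, dotProduct_mulVec_insertNth hτ.1, ← hw, ← hq, ← Complex.exp_add]
    congr 1
    simp only [dotProduct, Fin.sum_univ_succAbove _ i, Fin.insertNth_apply_same,
      Fin.insertNth_apply_succAbove, ← hL]
    ring
  have e2 : ∑' k : ℤ, thetaTerm (partialInv τ i)
      (fun j => ((Function.update ε₂ i (-ε₁ i) j : ℤ) : ℂ))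
      (fun j => ((i.insertNth k v : Fin (g + 1) → ℤ) j : ℂ) +
        ((Function.update ε₁ i (ε₂ i) j : ℤ) : ℂ) / 2)
      = cexp (π * I * (q + L + w * ε₁ i)) *
        thetaSum (-1 / τ i i) (w + ε₂ i / 2) (-ε₁ i) := by
    rw [thetaSum, ← tsum_mul_left]
    refine tsum_congr fun k => ?_
    rw [hx', thetaTerm, dotProduct_mulVec_insertNth hτ'.1, hw', hq', ← Complex.exp_add]
    congr 1
    simp only [dotProduct, Fin.sum_univ_succAbove _ i, Fin.insertNth_apply_same,
      Fin.insertNth_apply_succAbove, Function.update_self, ne_eq, Fin.succAbove_ne,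
      not_false_eq_true, Function.update_of_ne, ← hL]
    have : partialInv τ i i i = -1 / τ i i := by simp [partialInv]
    rw [this]
    push_cast
    field_simp
    ring
  rw [e1, e2, thetaSum_functional_equation him]
  have a1 : (2 * w + ε₂ i) / 2 = w + ε₂ i / 2 := by ring
  have a2 : -2 * ((ε₁ i : ℂ) / 2) = -ε₁ i := by ring
  rw [a1, a2]
  have a3 : cexp (π * I * (q + L)) * cexp (π * I * ((ε₁ i : ℂ) / 2 * (2 * w + ε₂ i)))
      = cexp (π * I * (ε₁ i * ε₂ i / 2)) * cexp (π * I * (q + L + w * ε₁ i)) := by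
    rw [← Complex.exp_add, ← Complex.exp_add]; congr 1; ring
  linear_combination 1 / (-I * τ i i) ^ (1 / 2 : ℂ) *
    thetaSum (-1 / τ i i) (w + ε₂ i / 2) (-ε₁ i) * a3

end SeveralVariables

/-! ### The transformation of the product of the even theta constants -/

section Chi

open scoped Real

/-- The primitive eighth root of unity `exp (π i / 4)`. -/
noncomputable def ζ₈ : ℂ := cexp (π * I / 4)

theorem ζ₈_pow (k : ℕ) : ζ₈ ^ k = cexp (π * I * (k / 4)) := by
  rw [ζ₈, ← Complex.exp_nat_mul]; congr 1; ring

theorem ζ₈_pow_four : ζ₈ ^ 4 = -1 := by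
  rw [ζ₈_pow]; simp

theorem card_evenChars_three : (evenChars 3).card = 36 := by decide

/-- If an involution of the even characteristics relates the theta constants at `τ` and `τ'` up to
eighth roots of unity and a common factor, then it relates their products. -/
theorem chi_eq_of_involution {τ τ' : Matrix (Fin 3) (Fin 3) ℂ} (c : ℂ)
    (σ : (Fin 3 → Fin 2) × (Fin 3 → Fin 2) → (Fin 3 → Fin 2) × (Fin 3 → Fin 2))
    (k : (Fin 3 → Fin 2) × (Fin 3 → Fin 2) → ℕ) (hinv : ∀ e, σ (σ e) = e)
    (hσ : ∀ e ∈ evenChars 3, σ e ∈ evenChars 3)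
    (h : ∀ e, thetaNull (fun i => ((e.1 i : ℕ) : ℤ)) (fun i => ((e.2 i : ℕ) : ℤ)) τ
      = c * ζ₈ ^ k e *
        thetaNull (fun i => (((σ e).1 i : ℕ) : ℤ)) (fun i => (((σ e).2 i : ℕ) : ℤ)) τ') :
    chi τ = c ^ 36 * ζ₈ ^ (∑ e ∈ evenChars 3, k e) * chi τ' := by
  rw [chi, chi, Finset.prod_congr rfl fun e _ => h e, Finset.prod_mul_distrib,
    Finset.prod_mul_distrib, Finset.prod_const, card_evenChars_three, Finset.prod_pow_eq_pow_sum]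
  congr 1
  exact Finset.prod_bij' (fun e _ => σ e) (fun e _ => σ e) hσ hσ (fun e _ => hinv e)
    (fun e _ => hinv e) (fun _ _ => rfl)

theorem thetaNull_congr_mod_two {g : ℕ} (ε₁ ε₂ ε₂' b : Fin g → ℤ)
    (τ : Matrix (Fin g) (Fin g) ℂ) (h : ∀ i, ε₂ i = ε₂' i + 2 * b i) :
    thetaNull ε₁ ε₂ τ = cexp (π * I * ∑ i, (ε₁ i * b i : ℂ)) * thetaNull ε₁ ε₂' τ := by
  rw [funext h, thetaNull_add_two_mul]

theorem fin_two_cases (a : Fin 2) : a = 0 ∨ a = 1 := by omega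

/-- The exponent of `ζ₈` that `τ ↦ τ + single i i 1` collects over the even characteristics. -/
theorem sum_evenChars_single (i : Fin 3) : (∑ e ∈ evenChars 3, (e.1 i : ℕ)) = 4 * 4 := by
  revert i; decide

/-- The exponent of `ζ₈` that translation by a symmetrized off-diagonal matrix unit collects over
the even characteristics: `6` comes from `exp (-(π i a i a j / 2)) = ζ₈ ^ (-2 a i a j)`, and
`4 b i + 4 b j` from the signs in the reduction of the lower characteristic modulo `2`. -/
theorem sum_evenChars_pair : ∀ i j : Fin 3, i ≠ j → (∑ e ∈ evenChars 3,
    (e.1 i : ℕ) * (e.1 j : ℕ) * (6 + 4 * (e.2 i : ℕ) + 4 * (e.2 j : ℕ))) % 8 = 0 := by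
  decide

/-- The exponent of `ζ₈` that partial inversion collects over the even characteristics. -/
theorem sum_evenChars_inversion (i : Fin 3) :
    (∑ e ∈ evenChars 3, 6 * ((e.1 i : ℕ) * (e.2 i : ℕ))) = 4 * 9 := by
  revert i; decide

/-- The action of translation by a symmetrized off-diagonal matrix unit on even characteristics. -/
theorem evenChars_shear_mem : ∀ i j : Fin 3, i ≠ j → ∀ e ∈ evenChars 3,
    (e.1, Function.update (Function.update e.2 i (e.2 i + e.1 j)) j (e.2 j + e.1 i))
      ∈ evenChars 3 := by
  intro i j
  fin_cases i <;> fin_cases j <;> decide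

/-- The action of partial inversion on even characteristics. -/
theorem evenChars_swap_mem : ∀ i : Fin 3, ∀ e ∈ evenChars 3,
    (Function.update e.1 i (e.2 i), Function.update e.2 i (e.1 i)) ∈ evenChars 3 := by
  decide

theorem update_add_involutive : ∀ i j : Fin 3, i ≠ j → ∀ a b : Fin 3 → Fin 2,
    (Function.update (Function.update (Function.update (Function.update b i (b i + a j)) j
      (b j + a i)) i ((Function.update (Function.update b i (b i + a j)) j (b j + a i)) i + a j)) j
      ((Function.update (Function.update b i (b i + a j)) j (b j + a i)) j + a i)) = b := by
  decide

/-- The `16` even characteristics with `ε₁ i = 1` contribute `ζ₈ ^ 16 = 1`. -/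
theorem chi_add_single (τ : Matrix (Fin 3) (Fin 3) ℂ) (i : Fin 3) :
    chi (τ + Matrix.single i i 1) = chi τ := by
  have key := chi_eq_of_involution (τ := τ + Matrix.single i i 1) (τ' := τ) 1
    (fun e => (e.1, Function.update e.2 i (e.2 i + 1 + e.1 i))) (fun e => (e.1 i : ℕ))
    (by revert i; decide) (by revert i; decide) (fun e => by
      obtain ⟨a, b⟩ := e
      simp only
      rw [thetaNull_add_single, thetaNull_congr_mod_two _ _
        (fun k => (((Function.update b i (b i + 1 + a i) k : Fin 2) : ℕ) : ℤ))
        (fun k => if k = i then ((b i : ℕ) : ℤ) * (1 - ((a i : ℕ) : ℤ)) else 0), ζ₈_pow]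
      · rw [one_mul, ← mul_assoc]
        congr 1
        rcases fin_two_cases (a i) with h | h <;> simp [h]
        congr 1; ring
      · intro k
        by_cases hk : k = i
        · subst hk
          rcases fin_two_cases (a k) with h | h <;> rcases fin_two_cases (b k) with h' | h' <;>
            simp [h, h']
        · simp [hk])
  rw [key, sum_evenChars_single, pow_mul, ζ₈_pow_four]
  norm_num

theorem chi_add_single_add_single (τ : Matrix (Fin 3) (Fin 3) ℂ) {i j : Fin 3} (hij : i ≠ j) :
    chi (τ + (Matrix.single i j 1 + Matrix.single j i 1)) = chi τ := by
  have key := chi_eq_of_involution (τ := τ + (Matrix.single i j 1 + Matrix.single j i 1))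
    (τ' := τ) 1
    (fun e => (e.1, Function.update (Function.update e.2 i (e.2 i + e.1 j)) j (e.2 j + e.1 i)))
    (fun e => (e.1 i : ℕ) * (e.1 j : ℕ) * (6 + 4 * (e.2 i : ℕ) + 4 * (e.2 j : ℕ)))
    (fun e => Prod.ext rfl (update_add_involutive i j hij e.1 e.2)) (evenChars_shear_mem i j hij)
    (fun e => by
      obtain ⟨a, b⟩ := e
      simp only
      rw [thetaNull_add_single_add_single, thetaNull_congr_mod_two _ _
        (fun k => (((Function.update (Function.update b i (b i + a j)) j (b j + a i) k : Fin 2) :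
          ℕ) : ℤ))
        (fun k => (if k = i then ((b i : ℕ) : ℤ) * ((a j : ℕ) : ℤ) else 0) +
          (if k = j then ((b j : ℕ) : ℤ) * ((a i : ℕ) : ℤ) else 0)), ζ₈_pow]
      · rw [one_mul, ← mul_assoc]
        congr 1
        rw [← Complex.exp_add, Complex.exp_eq_exp_iff_exists_int]
        refine ⟨-((a i : ℕ) * (a j : ℕ)), ?_⟩
        push_cast
        simp [mul_add, Finset.sum_add_distrib]
        ring
      · intro k
        by_cases hk : k = i
        · subst hk
          rcases fin_two_cases (a j) with h | h <;> rcases fin_two_cases (b k) with h' | h' <;>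
            simp [h, h', hij]
        · by_cases hk' : k = j
          · subst hk'
            rcases fin_two_cases (a i) with h | h <;> rcases fin_two_cases (b k) with h' | h' <;>
              simp [h, h', hk]
          · simp [hk, hk'])
  obtain ⟨m, hm⟩ := Nat.dvd_of_mod_eq_zero (sum_evenChars_pair i j hij)
  rw [key, hm, show 8 * m = 4 * (2 * m) by ring, pow_mul, ζ₈_pow_four]
  simp

/-- `χ` has weight `36 / 2 = 18`: the sign of `(-i τ)^18` is cancelled by that of the roots of
unity. -/
theorem chi_partialInv {τ : Matrix (Fin 3) (Fin 3) ℂ} (i : Fin 3)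
    (hτ : IsSiegel τ) (hτ' : IsSiegel (partialInv τ i)) :
    chi (partialInv τ i) = τ i i ^ 18 * chi τ := by
  have key := chi_eq_of_involution (τ := τ) (τ' := partialInv τ i)
    (1 / (-I * τ i i) ^ (1 / 2 : ℂ))
    (fun e => (Function.update e.1 i (e.2 i), Function.update e.2 i (e.1 i)))
    (fun e => 6 * ((e.1 i : ℕ) * (e.2 i : ℕ)))
    (fun e => by simp) (evenChars_swap_mem i) (fun e => by
      obtain ⟨a, b⟩ := e
      simp only
      rw [thetaNull_partialInv i hτ hτ', thetaNull_congr_mod_two _ _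
        (fun k => (((Function.update b i (a i) k : Fin 2) : ℕ) : ℤ))
        (fun k => if k = i then -((a i : ℕ) : ℤ) else 0), ζ₈_pow,
        mul_assoc (1 / (-I * τ i i) ^ (1 / 2 : ℂ))]
      · have hf' : (fun k => (((Function.update a i (b i) k : Fin 2) : ℕ) : ℤ))
            = Function.update (fun k => ((a k : ℕ) : ℤ)) i ((b i : ℕ) : ℤ) := by
          ext k
          by_cases hk : k = i
          · subst hk; simp
          · simp [hk]
        rw [hf', ← mul_assoc (cexp _) (cexp _)]
        congr 2
        rw [← Complex.exp_add, Complex.exp_eq_exp_iff_exists_int]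
        refine ⟨-((a i : ℕ) * (b i : ℕ)), ?_⟩
        push_cast
        simp
        ring
      · intro k
        by_cases hk : k = i
        · subst hk; simp; ring
        · simp [hk])
  have h0 : τ i i ≠ 0 := by
    have him := hτ.im_diag_pos i
    intro h; rw [h] at him; simp at him
  have hc : (1 / (-I * τ i i) ^ (1 / 2 : ℂ)) ^ 36 = -1 / τ i i ^ 18 := by
    have h1 : ((-I * τ i i) ^ (1 / 2 : ℂ)) ^ 36 = (-I * τ i i) ^ 18 := by
      rw [← Complex.cpow_nat_mul, ← Complex.cpow_natCast]
      congr 1; norm_num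
    have h2 : (-I) ^ 18 = -1 := by
      rw [show (18 : ℕ) = 2 * 9 by norm_num, pow_mul, neg_sq, I_sq]; norm_num
    rw [div_pow, h1, one_pow, mul_pow, h2, neg_one_mul, div_neg, neg_div]
  rw [key, sum_evenChars_inversion, hc, pow_mul, ζ₈_pow_four]
  generalize chi (partialInv τ i) = X
  generalize τ i i = t at h0
  field_simp

end Chi

end Ciani

noncomputable section

open scoped ComplexOrder

namespace Ciani

open Complex Matrix

/-! ### Invariance of `χ₁₈` under the integral symplectic group -/

section Invariance

/-- The Riemann conditions. They imply that the columns of `Ω` are a real basis. -/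
def IsRiemann {g : ℕ} (Ω : PMat g) : Prop :=
  Ω * stdJ g * Ω.transpose = 0 ∧ (polarization Ω).PosDef

theorem stdJ_eq (g : ℕ) : stdJ g = -Matrix.J (Fin g) ℂ := by
  simp [stdJ, Matrix.J, fromBlocks_neg]

theorem stdJ_inv (g : ℕ) : (stdJ g)⁻¹ = Matrix.J (Fin g) ℂ := by
  refine Matrix.inv_eq_right_inv ?_
  rw [stdJ_eq, Matrix.neg_mul, J_squared, neg_neg]

/-- The matrix `conj Ω J⁻¹ ᵗΩ`, whose inverse is the polarization up to a scalar. -/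
def pairing {g : ℕ} (Ω : PMat g) : Matrix (Fin g) (Fin g) ℂ :=
  Ω.map (starRingEnd ℂ) * (stdJ g)⁻¹ * Ω.transpose

theorem pairing_eq {g : ℕ} (Ω : PMat g) :
    pairing Ω = Ω.toCols₂.map (starRingEnd ℂ) * Ω.toCols₁.transpose
      - Ω.toCols₁.map (starRingEnd ℂ) * Ω.toCols₂.transpose := by
  have h : Ω.map (starRingEnd ℂ)
      = fromCols (Ω.toCols₁.map (starRingEnd ℂ)) (Ω.toCols₂.map (starRingEnd ℂ)) := by
    ext i (j | j) <;> simp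
  rw [pairing, h, stdJ_inv, ← fromCols_toCols Ω, transpose_fromCols, Matrix.J,
    fromCols_mul_fromBlocks, fromCols_mul_fromRows]
  simp [sub_eq_add_neg]

theorem mul_stdJ_mul_transpose {g : ℕ} (Ω : PMat g) :
    Ω * stdJ g * Ω.transpose
      = Ω.toCols₁ * Ω.toCols₂.transpose - Ω.toCols₂ * Ω.toCols₁.transpose := by
  conv_lhs => rw [← fromCols_toCols Ω]
  rw [transpose_fromCols, stdJ, fromCols_mul_fromBlocks, fromCols_mul_fromRows]
  simp [sub_eq_add_neg, add_comm]

/-- The inverse of the polarization is positive definite. -/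
theorem IsRiemann.posDef_pairing {g : ℕ} {Ω : PMat g} (h : IsRiemann Ω) :
    ((2 * I)⁻¹ • pairing Ω).PosDef ∧ IsUnit (pairing Ω).det := by
  have h2 : (2 * I : ℂ) ≠ 0 := by simp
  have hu : IsUnit (pairing Ω)⁻¹.det := by
    have := (Matrix.isUnit_iff_isUnit_det _).1 h.2.isUnit
    change IsUnit (((2 * I) • (pairing Ω)⁻¹).det) at this
    rw [det_smul] at this
    exact isUnit_of_mul_isUnit_right this
  have hu' : IsUnit (pairing Ω).det := by
    rw [Matrix.det_nonsing_inv, Ring.inverse_eq_inv', isUnit_iff_ne_zero] at hu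
    rw [isUnit_iff_ne_zero]
    exact fun h0 => hu (by rw [h0, _root_.inv_zero])
  refine ⟨?_, hu'⟩
  have h3 := h.2.inv
  have : (polarization Ω)⁻¹ = (2 * I)⁻¹ • pairing Ω := by
    refine Matrix.inv_eq_right_inv ?_
    change (2 * I) • (pairing Ω)⁻¹ * ((2 * I)⁻¹ • pairing Ω) = 1
    rw [smul_mul_smul_comm, mul_inv_cancel₀ h2, one_smul, nonsing_inv_mul _ hu']
  rwa [this] at h3

/-- A vector `v` with `ᵗΩ₂ v = 0` is isotropic for the inverse of the polarization. -/
theorem IsRiemann.isUnit_det {g : ℕ} {Ω : PMat g} (h : IsRiemann Ω) :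
    IsUnit Ω.toCols₂.det := by
  by_contra hdet
  rw [isUnit_iff_ne_zero, not_not, ← det_transpose] at hdet
  obtain ⟨v, hv, hv0⟩ := Matrix.exists_mulVec_eq_zero_iff.2 hdet
  have hpos := h.posDef_pairing.1.dotProduct_mulVec_pos hv
  have h1 : star v ᵥ* Ω.toCols₂.map (starRingEnd ℂ) = 0 := by
    have : star v ᵥ* Ω.toCols₂.map (starRingEnd ℂ) = star (Ω.toCols₂.transpose *ᵥ v) := by
      rw [star_mulVec Ω.toCols₂.transpose v]; congr 1
    rw [this, hv0, star_zero]
  have h2 : star v ⬝ᵥ pairing Ω *ᵥ v = 0 := by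
    rw [pairing_eq, sub_mulVec, ← mulVec_mulVec, ← mulVec_mulVec, hv0, mulVec_zero, sub_zero,
      dotProduct_mulVec, h1, zero_dotProduct]
  rw [smul_mulVec, dotProduct_smul, h2, smul_zero] at hpos
  exact lt_irrefl _ hpos

theorem toCols₂_mul_riemannMatrix {g : ℕ} {Ω : PMat g} (h : IsRiemann Ω) :
    Ω.toCols₂ * riemannMatrix Ω = Ω.toCols₁ := by
  rw [riemannMatrix, ← Matrix.mul_assoc, mul_nonsing_inv _ h.isUnit_det, Matrix.one_mul]

/-- With `Ω = Ω₂ [τ 1]`, the alternating condition says that `τ` is symmetric, and positivity that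
`conj Ω₂ (Im τ) ᵗΩ₂` is positive definite. -/
theorem IsRiemann.isSiegel {g : ℕ} {Ω : PMat g} (h : IsRiemann Ω) :
    IsSiegel (riemannMatrix Ω) := by
  have hu := h.isUnit_det
  have h1 := toCols₂_mul_riemannMatrix h
  set τ := riemannMatrix Ω with hτ
  have hut : IsUnit Ω.toCols₂.transpose.det := by rwa [det_transpose]
  have hsymm : τ.transpose = τ := by
    have h2 := h.1
    rw [mul_stdJ_mul_transpose, ← h1, transpose_mul, Matrix.mul_assoc, ← Matrix.mul_sub] at h2
    have h3 : τ * Ω.toCols₂.transpose - τ.transpose * Ω.toCols₂.transpose = 0 := by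
      have := congrArg (fun A => Ω.toCols₂⁻¹ * A) h2
      simpa [← Matrix.mul_assoc, nonsing_inv_mul _ hu] using this
    rw [← Matrix.sub_mul] at h3
    have := congrArg (fun A => A * Ω.toCols₂.transpose⁻¹) h3
    simp only [Matrix.mul_assoc, mul_nonsing_inv _ hut, Matrix.mul_one, Matrix.zero_mul] at this
    exact (sub_eq_zero.1 this).symm
  refine ⟨hsymm, Matrix.PosDef.of_dotProduct_mulVec_pos ?_ ?_⟩
  · ext i j
    have := congrFun (congrFun hsymm i) j
    simp only [transpose_apply] at this
    simp [conjTranspose_apply, this]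
  · intro x hx
    have hpair : pairing Ω = Ω.toCols₂.map (starRingEnd ℂ) * (τ - τ.map (starRingEnd ℂ)) *
        Ω.toCols₂.transpose := by
      rw [pairing_eq, ← h1, transpose_mul, hsymm, Matrix.map_mul, Matrix.mul_sub, Matrix.sub_mul,
        ← Matrix.mul_assoc]
    have him : τ - τ.map (starRingEnd ℂ) = (2 * I) • (τ.map im).map (fun r : ℝ => (r : ℂ)) := by
      ext i j
      simp only [Matrix.sub_apply, map_apply, Matrix.smul_apply, smul_eq_mul]
      rw [Complex.sub_conj]; push_cast; ring
    set xc : Fin g → ℂ := fun i => (x i : ℂ) with hxc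
    set v := Ω.toCols₂.transpose⁻¹ *ᵥ xc with hv
    have hv1 : Ω.toCols₂.transpose *ᵥ v = xc := by
      rw [hv, mulVec_mulVec, mul_nonsing_inv _ hut, one_mulVec]
    have hv0 : v ≠ 0 := by
      intro h0
      rw [h0, mulVec_zero] at hv1
      exact hx (funext fun i => by simpa [hxc] using (congrFun hv1 i).symm)
    have hpos := h.posDef_pairing.1.dotProduct_mulVec_pos hv0
    have h3 : star v ᵥ* Ω.toCols₂.map (starRingEnd ℂ) = xc := by
      have : star v ᵥ* Ω.toCols₂.map (starRingEnd ℂ) = star (Ω.toCols₂.transpose *ᵥ v) := by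
        rw [star_mulVec Ω.toCols₂.transpose v]; congr 1
      rw [this, hv1]; ext i; simp [hxc]
    rw [hpair, him, Matrix.mul_smul, Matrix.smul_mul, smul_smul, inv_mul_cancel₀ (by simp),
      one_smul, ← mulVec_mulVec, ← mulVec_mulVec, hv1, dotProduct_mulVec, h3] at hpos
    have h4 : xc ⬝ᵥ (τ.map im).map (fun r : ℝ => (r : ℂ)) *ᵥ xc
        = ((x ⬝ᵥ (τ.map im) *ᵥ x : ℝ) : ℂ) := by
      simp [dotProduct, mulVec, hxc]
    rw [h4] at hpos
    simpa using hpos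

/-- Integer matrices as complex matrices. -/
abbrev toComplex {m n : Type*} (M : Matrix m n ℤ) : Matrix m n ℂ :=
  M.map (Int.castRingHom ℂ)

theorem toComplex_symplectic {g : ℕ} {M : Matrix (Fin g ⊕ Fin g) (Fin g ⊕ Fin g) ℤ}
    (hM : M ∈ symplecticGroup (Fin g) ℤ) :
    toComplex M * Matrix.J (Fin g) ℂ * (toComplex M).transpose = Matrix.J (Fin g) ℂ := by
  rw [SymplecticGroup.mem_iff] at hM
  have := congrArg toComplex hM
  rwa [toComplex, Matrix.map_mul, Matrix.map_mul, toComplex, Matrix.map_J, transpose_map] at this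

theorem pairing_mul_symplectic {g : ℕ} (Ω : PMat g)
    {M : Matrix (Fin g ⊕ Fin g) (Fin g ⊕ Fin g) ℤ} (hM : M ∈ symplecticGroup (Fin g) ℤ) :
    pairing (Ω * toComplex M) = pairing Ω := by
  have h : (Ω * toComplex M).map (starRingEnd ℂ) = Ω.map (starRingEnd ℂ) * toComplex M := by
    rw [Matrix.map_mul]; congr 1; ext i j; simp
  rw [pairing, h, transpose_mul, pairing, stdJ_inv]
  conv_rhs => rw [← toComplex_symplectic hM]
  simp only [Matrix.mul_assoc]

theorem IsRiemann.mul_symplectic {g : ℕ} {Ω : PMat g} (h : IsRiemann Ω)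
    {M : Matrix (Fin g ⊕ Fin g) (Fin g ⊕ Fin g) ℤ} (hM : M ∈ symplecticGroup (Fin g) ℤ) :
    IsRiemann (Ω * toComplex M) := by
  refine ⟨?_, ?_⟩
  · have h1 := h.1
    rw [stdJ_eq, Matrix.mul_neg, Matrix.neg_mul, neg_eq_zero, ← toComplex_symplectic hM] at h1
    rw [stdJ_eq, Matrix.mul_neg, Matrix.neg_mul, neg_eq_zero, transpose_mul]
    simpa only [Matrix.mul_assoc] using h1
  · have h2 := h.2
    change ((2 * I) • (pairing (Ω * toComplex M))⁻¹).PosDef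
    rw [pairing_mul_symplectic Ω hM]
    exact h2

/-- The value of `χ₁₈` after a change of the period matrix by an automorphism of `ℂ³`. -/
theorem chi18_eq_of_toCols {Ω : PMat 3} {B τ : Matrix (Fin 3) (Fin 3) ℂ} (hB : IsUnit B.det)
    (h2 : Ω.toCols₂ = B) (h1 : Ω.toCols₁ = B * τ) :
    chi18 Ω = (B.det ^ 18)⁻¹ * chi τ := by
  rw [chi18, riemannMatrix, h2, h1, ← Matrix.mul_assoc, nonsing_inv_mul _ hB, Matrix.one_mul]

theorem toComplex_single {g : ℕ} (i j : Fin g) :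
    toComplex (Matrix.single i j (1 : ℤ)) = Matrix.single i j 1 := by
  ext a b; simp [Matrix.single_apply]

theorem single_one_mul_apply {g : ℕ} (i : Fin g) (P : Matrix (Fin g) (Fin g) ℂ) (j k : Fin g) :
    ((Matrix.single i i 1 : Matrix (Fin g) (Fin g) ℂ) * P) j k = if j = i then P i k else 0 := by
  by_cases h : j = i
  · simp [Matrix.mul_apply, Matrix.single_apply, h]
  · simp [Matrix.mul_apply, h, Ne.symm h]

theorem mul_single_one_apply {g : ℕ} (i : Fin g) (P : Matrix (Fin g) (Fin g) ℂ) (j k : Fin g) :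
    (P * (Matrix.single i i 1 : Matrix (Fin g) (Fin g) ℂ)) j k = if k = i then P j i else 0 := by
  by_cases h : k = i
  · simp [Matrix.mul_apply, Matrix.single_apply, h]
  · simp [Matrix.mul_apply, h, Ne.symm h]

/-- The symplectic translation matrix attached to a symmetric integral matrix. -/
def translation (S : Matrix (Fin 3) (Fin 3) ℤ) : Matrix (Fin 3 ⊕ Fin 3) (Fin 3 ⊕ Fin 3) ℤ :=
  fromBlocks 1 0 S 1

/-- The symplectic matrices under which `χ₁₈` is invariant. -/
def chiInvariant : Submonoid (Matrix (Fin 3 ⊕ Fin 3) (Fin 3 ⊕ Fin 3) ℤ) where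
  carrier := {M | M ∈ symplecticGroup (Fin 3) ℤ ∧
    ∀ Ω : PMat 3, IsRiemann Ω → chi18 (Ω * toComplex M) = chi18 Ω}
  one_mem' := ⟨one_mem _, fun Ω _ => by simp [toComplex]⟩
  mul_mem' := by
    rintro M N ⟨hM, hM'⟩ ⟨hN, hN'⟩
    refine ⟨mul_mem hM hN, fun Ω hΩ => ?_⟩
    rw [toComplex, Matrix.map_mul, ← Matrix.mul_assoc, hN' _ (hΩ.mul_symplectic hM), hM' _ hΩ]

theorem translation_mem_symplecticGroup {S : Matrix (Fin 3) (Fin 3) ℤ} (hS : S.IsSymm) :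
    translation S ∈ symplecticGroup (Fin 3) ℤ := by
  rw [SymplecticGroup.mem_iff, translation, Matrix.J, fromBlocks_transpose, fromBlocks_multiply,
    fromBlocks_multiply]
  simp [hS.eq]

theorem translation_mul (S T : Matrix (Fin 3) (Fin 3) ℤ) :
    translation S * translation T = translation (S + T) := by
  simp [translation, fromBlocks_multiply]

/-- The symmetric integral matrices by which translation preserves `χ₁₈`. -/
def chiTranslations : AddSubgroup (Matrix (Fin 3) (Fin 3) ℤ) where
  carrier := {S | S.IsSymm ∧ translation S ∈ chiInvariant}
  zero_mem' := ⟨by simp [IsSymm], by simp [translation, one_mem]⟩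
  add_mem' := by
    rintro S T ⟨hS, hS'⟩ ⟨hT, hT'⟩
    exact ⟨hS.add hT, translation_mul S T ▸ mul_mem hS' hT'⟩
  neg_mem' := by
    rintro S ⟨hS, hS'⟩
    have hn := translation_mem_symplecticGroup hS.neg
    refine ⟨hS.neg, hn, fun Ω hΩ => ?_⟩
    rw [← hS'.2 _ (hΩ.mul_symplectic hn), Matrix.mul_assoc, ← Matrix.map_mul, translation_mul]
    simp [translation]

theorem mem_chiTranslations {S : Matrix (Fin 3) (Fin 3) ℤ} (hS : S.IsSymm)
    (h : ∀ τ, chi (τ + toComplex S) = chi τ) : S ∈ chiTranslations := by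
  refine ⟨hS, translation_mem_symplecticGroup hS, fun Ω hΩ => ?_⟩
  have e : toComplex (translation S) = fromBlocks 1 0 (toComplex S) 1 := by
    simp [translation, toComplex, fromBlocks_map]
  have e' : Ω * toComplex (translation S)
      = fromCols (Ω.toCols₁ + Ω.toCols₂ * toComplex S) Ω.toCols₂ := by
    conv_lhs => rw [← fromCols_toCols Ω]
    rw [e, fromCols_mul_fromBlocks]; simp
  rw [chi18_eq_of_toCols (τ := riemannMatrix Ω + toComplex S) hΩ.isUnit_det (by simp [e'])
    (by rw [Matrix.mul_add, toCols₂_mul_riemannMatrix hΩ]; simp [e']), h, chi18]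

theorem longRoot_mem_chiInvariant (i : Fin 3) (k : ℤ) : longRoot i k ∈ chiInvariant := by
  have h1 : Matrix.single i i (1 : ℤ) ∈ chiTranslations := mem_chiTranslations
    (by simp [IsSymm]) fun τ => by
      rw [toComplex_single, chi_add_single]
  have h2 := (zsmul_mem h1 k).2
  have : longRoot i k = translation (k • Matrix.single i i (1 : ℤ)) := by
    rw [longRoot, translation, ← fromBlocks_one]
    ext (a | a) (b | b) <;> simp [Matrix.single_apply, Matrix.one_apply]
  rwa [this]

theorem shortRoot_mem_chiInvariant {i j : Fin 3} (hij : i ≠ j) (k : ℤ) :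
    shortRoot i j k ∈ chiInvariant := by
  have h1 : Matrix.single i j (1 : ℤ) + Matrix.single j i 1 ∈ chiTranslations :=
    mem_chiTranslations (by simp [IsSymm, add_comm]) fun τ => by
      have : toComplex (Matrix.single i j (1 : ℤ) + Matrix.single j i 1)
          = Matrix.single i j 1 + Matrix.single j i 1 := by
        rw [toComplex, Matrix.map_add _ (map_add _)]
        exact congrArg₂ _ (toComplex_single _ _) (toComplex_single _ _)
      rw [this, chi_add_single_add_single τ hij]
  have h2 := (zsmul_mem h1 k).2
  have : shortRoot i j k
      = translation (k • (Matrix.single i j (1 : ℤ) + Matrix.single j i 1)) := by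
    rw [shortRoot, translation, ← fromBlocks_one]
    ext (a | a) (b | b) <;> simp [Matrix.single_apply, Matrix.one_apply]
  rwa [this]

theorem partialJ_eq (i : Fin 3) :
    partialJ i = fromBlocks (1 - Matrix.single i i 1) (-Matrix.single i i 1)
      (Matrix.single i i 1) (1 - Matrix.single i i 1) := by
  ext (a | a) (b | b) <;> simp [partialJ, Matrix.single_apply, Matrix.one_apply]

theorem partialJ_mem_symplecticGroup (i : Fin 3) :
    partialJ i ∈ symplecticGroup (Fin 3) ℤ := by
  rw [SymplecticGroup.mem_iff, partialJ_eq, Matrix.J, fromBlocks_transpose, fromBlocks_multiply,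
    fromBlocks_multiply]
  simp [Matrix.sub_mul, Matrix.mul_sub, ← sub_eq_neg_add]

theorem partialJ_mem_chiInvariant (i : Fin 3) : partialJ i ∈ chiInvariant := by
  have hSp := partialJ_mem_symplecticGroup i
  refine ⟨hSp, fun Ω hΩ => ?_⟩
  have hΩ' := hΩ.mul_symplectic hSp
  set τ := riemannMatrix Ω with hτ
  set e : Matrix (Fin 3) (Fin 3) ℂ := Matrix.single i i 1 with he
  have hmap : toComplex (partialJ i) = fromBlocks (1 - e) (-e) e (1 - e) := by
    rw [partialJ_eq, toComplex, fromBlocks_map, he]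
    congr 1 <;> ext a b <;> simp [Matrix.single_apply, Matrix.one_apply]
  have hτ0 : τ i i ≠ 0 := by
    have him := hΩ.isSiegel.im_diag_pos i
    intro h; rw [← hτ, h] at him; simp at him
  set C : Matrix (Fin 3) (Fin 3) ℂ := 1 - e - τ * e with hC
  -- `C` is the automorphy factor: `[τ 1] * partialJ i = C * [partialInv τ i 1]`.
  have hdet : C.det = -τ i i := by
    fin_cases i <;> simp [hC, he, det_fin_three, Matrix.single_apply, Matrix.mul_apply]
  have hCτ : C * partialInv τ i = τ * (1 - e) + e := by
    ext j k
    have h1 : (C * partialInv τ i) j k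
        = partialInv τ i j k - (if j = i then partialInv τ i i k else 0)
          - τ j i * partialInv τ i i k := by
      rw [hC, Matrix.sub_mul, Matrix.sub_mul, Matrix.one_mul, he, Matrix.sub_apply,
        Matrix.sub_apply, single_one_mul_apply, Matrix.mul_assoc, Matrix.mul_apply (M := τ)]
      simp [single_one_mul_apply]
    have h2 : (τ * (1 - e) + e) j k
        = (if k = i then 0 else τ j k) + (if j = i then if k = i then 1 else 0 else 0) := by
      rw [Matrix.mul_sub, Matrix.mul_one, he, Matrix.add_apply, Matrix.sub_apply,
        mul_single_one_apply]
      by_cases hj : j = i <;> by_cases hk : k = i <;>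
        simp [hj, hk, eq_comm (a := i)]
    rw [h1, h2]
    by_cases hj : j = i <;> by_cases hk : k = i
    · subst hj hk; simp [partialInv]; field_simp
    · subst hj; simp [partialInv, hk]; field_simp
    · subst hk; simp [partialInv, hj]; field_simp; ring
    · simp [partialInv, hj, hk]; field_simp; ring
  have h1 : (Ω * toComplex (partialJ i)).toCols₁ = Ω.toCols₂ * C * partialInv τ i := by
    rw [Matrix.mul_assoc, hCτ, Matrix.mul_add, ← Matrix.mul_assoc, toCols₂_mul_riemannMatrix hΩ]
    conv_lhs => rw [← fromCols_toCols Ω]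
    rw [hmap, fromCols_mul_fromBlocks]; simp
  have h2 : (Ω * toComplex (partialJ i)).toCols₂ = Ω.toCols₂ * C := by
    rw [hC, Matrix.mul_sub, ← Matrix.mul_assoc, toCols₂_mul_riemannMatrix hΩ]
    conv_lhs => rw [← fromCols_toCols Ω]
    rw [hmap, fromCols_mul_fromBlocks]; simp [sub_eq_add_neg, add_comm]
  have hu : IsUnit (Ω.toCols₂ * C).det := by
    rw [det_mul, hdet]
    exact hΩ.isUnit_det.mul (isUnit_iff_ne_zero.2 (neg_ne_zero.2 hτ0))
  have hτ' : riemannMatrix (Ω * toComplex (partialJ i)) = partialInv τ i := by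
    rw [riemannMatrix, h2, h1, ← Matrix.mul_assoc, nonsing_inv_mul _ hu, Matrix.one_mul]
  have hS := hΩ'.isSiegel
  rw [hτ'] at hS
  rw [chi18_eq_of_toCols hu h2 h1, chi_partialInv i hΩ.isSiegel hS, det_mul, hdet, chi18, ← hτ]
  have := hΩ.isUnit_det.ne_zero
  field_simp

/-- `χ₁₈` is a Siegel modular form for the full integral symplectic group. -/
theorem chi18_mul_symplectic {Ω : PMat 3} (hΩ : IsRiemann Ω)
    {M : Matrix (Fin 3 ⊕ Fin 3) (Fin 3 ⊕ Fin 3) ℤ} (hM : M ∈ symplecticGroup (Fin 3) ℤ) :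
    chi18 (Ω * toComplex M) = chi18 Ω := by
  obtain ⟨E, hE, hME⟩ := exists_mul_eq_one_of_mem_symplecticGroup (𝓔 := chiInvariant)
    (fun _ h => h.1) longRoot_mem_chiInvariant partialJ_mem_chiInvariant
    (fun _ _ k h => shortRoot_mem_chiInvariant h k) hM
  rw [← hE.2 _ (hΩ.mul_symplectic hM), Matrix.mul_assoc, ← Matrix.map_mul, hME]
  simp

end Invariance

/-! ### Theta constants of the isogenous threefold -/

section Isogeny

open scoped Real

/-- The Riemann matrix of the quotient of `∏ ℂ / (ℤ τ i + ℤ)` by the subgroup `W`, in a suitable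
symplectic basis. Its quadratic form is `2 ∑ τ i (x i)²` on the body centred cubic lattice
`ℤ³ ∪ (ℤ³ + (1/2, 1/2, 1/2))`, written in the basis `e₀, e₁, (e₀ + e₁ + e₂) / 2`. -/
def isogenyMatrix (τ : Fin 3 → ℂ) : Matrix (Fin 3) (Fin 3) ℂ :=
  !![2 * τ 0, 0, τ 0; 0, 2 * τ 1, τ 1; τ 0, τ 1, (τ 0 + τ 1 + τ 2) / 2]

/-- The theta series at `2τ` with upper characteristic in `ℤ / 4`. -/
def quarterTheta (τ : ℂ) (a b : ℤ) : ℂ := thetaSum (2 * τ) (a / 4) b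

/-- The decomposition of the body centred cubic lattice, in the basis `e₀, e₁, (e₀ + e₁ + e₂) / 2`,
into two cosets of `ℤ³`: the vector with coordinates `n` lies in the coset of `n 2` modulo `2`. -/
def latticeSplit : Fin 2 × (Fin 3 → ℤ) ≃ (Fin 3 → ℤ) where
  toFun p := ![p.2 0 - p.2 2, p.2 1 - p.2 2, 2 * p.2 2 + (p.1 : ℕ)]
  invFun n := (⟨(n 2 % 2).toNat, by omega⟩, ![n 0 + n 2 / 2, n 1 + n 2 / 2, n 2 / 2])
  left_inv := by
    rintro ⟨r, m⟩
    have h1 : (2 * m 2 + (r : ℕ) : ℤ) / 2 = m 2 := by omega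
    have h2 : (2 * m 2 + (r : ℕ) : ℤ) % 2 = (r : ℕ) := by omega
    ext i
    · simp [h2]
    · fin_cases i <;> simp [h1]
  right_inv := by
    intro n
    ext i
    fin_cases i <;> simp
    omega

/-- The theta constants of the quotient: each of the two cosets of `ℤ³` in the body centred cubic
lattice contributes a product of three theta series in one variable. -/
theorem thetaNull_isogenyMatrix {τ : Fin 3 → ℂ} (hτ : ∀ i, 0 < (τ i).im)
    (hS : IsSiegel (isogenyMatrix τ)) (ε₁ ε₂ : Fin 3 → ℤ) :
    thetaNull ε₁ ε₂ (isogenyMatrix τ)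
      = quarterTheta (τ 0) (2 * ε₁ 0 + ε₁ 2) (ε₂ 0) * quarterTheta (τ 1) (2 * ε₁ 1 + ε₁ 2) (ε₂ 1) *
          quarterTheta (τ 2) (ε₁ 2) (2 * ε₂ 2 - ε₂ 0 - ε₂ 1)
        + quarterTheta (τ 0) (2 * ε₁ 0 + ε₁ 2 + 2) (ε₂ 0) *
          quarterTheta (τ 1) (2 * ε₁ 1 + ε₁ 2 + 2) (ε₂ 1) *
          quarterTheta (τ 2) (ε₁ 2 + 2) (2 * ε₂ 2 - ε₂ 0 - ε₂ 1) := by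
  have h := summable_thetaTerm hS ε₁ ε₂
  rw [thetaNull_eq, ← latticeSplit.tsum_eq]
  refine (Summable.tsum_prod (latticeSplit.summable_iff.2 h)).trans ?_
  rw [tsum_fintype, Fin.sum_univ_two]
  set α : Fin 3 → ℂ := ![(2 * ε₁ 0 + ε₁ 2) / 4, (2 * ε₁ 1 + ε₁ 2) / 4, ε₁ 2 / 4] with hα
  set β : Fin 3 → ℂ := ![ε₂ 0, ε₂ 1, 2 * ε₂ 2 - ε₂ 0 - ε₂ 1] with hβ
  have key : ∀ r : Fin 2, ∑' m : Fin 3 → ℤ, thetaTerm (isogenyMatrix τ) (fun i => (ε₂ i : ℂ))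
      (fun i => (latticeSplit (r, m) i : ℂ) + (ε₁ i : ℂ) / 2)
      = ∏ i, thetaSum (2 * τ i) (α i + ((r : ℕ) : ℂ) / 2) (β i) := by
    intro r
    have h2 : ∀ i, 0 < (2 * τ i).im := fun i => by simpa using hτ i
    simp only [thetaSum]
    rw [← (tsum_pi_prod _ fun i => (summable_thetaSum (h2 i) _ (β i)).norm).2]
    refine tsum_congr fun m => ?_
    rw [← Complex.exp_sum, thetaTerm]
    congr 1
    simp [latticeSplit, isogenyMatrix, Fin.sum_univ_three, dotProduct, mulVec, hα, hβ]
    ring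
  have key0 := key 0
  have key1 := key 1
  simp only [Fin.prod_univ_three] at key0 key1
  refine (congrArg₂ (· + ·) key0 key1).trans ?_
  simp only [quarterTheta, hα, hβ]
  push_cast
  simp
  have e : ∀ x : ℂ, x / 4 + 2⁻¹ = (x + 2) / 4 := fun x => by ring
  simp only [e]

theorem quarterTheta_add_four (τ : ℂ) (a b : ℤ) :
    quarterTheta τ (a + 4) b = quarterTheta τ a b := by
  rw [quarterTheta, quarterTheta, ← thetaSum_add_one _ ((a : ℂ) / 4)]
  congr 1; push_cast; ring

theorem quarterTheta_neg (τ : ℂ) (a b : ℤ) :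
    quarterTheta τ (-a) (-b) = quarterTheta τ a b := by
  rw [quarterTheta, quarterTheta, ← thetaSum_neg]
  push_cast
  congr 1 <;> ring

theorem quarterTheta_add_two (τ : ℂ) (a b : ℤ) :
    quarterTheta τ a (b + 2) = I ^ a * quarterTheta τ a b := by
  have h : I ^ a = cexp (2 * π * I * (a / 4)) := by
    conv_lhs => rw [← Complex.exp_pi_div_two_mul_I]
    rw [← Complex.exp_int_mul]
    congr 1; ring
  rw [quarterTheta, quarterTheta, h, ← thetaSum_add_two]
  push_cast
  rfl

section Table

variable (τ : ℂ)

@[simp] theorem quarterTheta_zero_zero : quarterTheta τ 0 0 = θ₃ (2 * τ) := by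
  simp [quarterTheta, θ₃]

@[simp] theorem quarterTheta_zero_one : quarterTheta τ 0 1 = θ₄ (2 * τ) := by
  simp [quarterTheta, θ₄]

@[simp] theorem quarterTheta_two_zero : quarterTheta τ 2 0 = θ₂ (2 * τ) := by
  simp only [quarterTheta, θ₂]; norm_num

@[simp] theorem quarterTheta_two_one : quarterTheta τ 2 1 = 0 := by
  have := thetaSum_half_one (2 * τ)
  simp only [quarterTheta]; norm_num at this ⊢; exact this

@[simp] theorem quarterTheta_zero_neg_one : quarterTheta τ 0 (-1) = θ₄ (2 * τ) := by
  rw [← quarterTheta_zero_one, ← quarterTheta_neg]; simp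

@[simp] theorem quarterTheta_zero_two : quarterTheta τ 0 2 = θ₃ (2 * τ) := by
  have := quarterTheta_add_two τ 0 0
  simpa [quarterTheta_zero_zero] using this

@[simp] theorem quarterTheta_zero_neg_two : quarterTheta τ 0 (-2) = θ₃ (2 * τ) := by
  rw [← quarterTheta_zero_two, ← quarterTheta_neg]; simp

@[simp] theorem quarterTheta_two_two : quarterTheta τ 2 2 = -θ₂ (2 * τ) := by
  have := quarterTheta_add_two τ 2 0
  rw [quarterTheta_two_zero] at this
  simpa using this

@[simp] theorem quarterTheta_two_neg_two : quarterTheta τ 2 (-2) = -θ₂ (2 * τ) := by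
  rw [← quarterTheta_neg, ← quarterTheta_add_four]; exact quarterTheta_two_two τ

@[simp] theorem quarterTheta_one_two : quarterTheta τ 1 2 = I * quarterTheta τ 1 0 := by
  simpa using quarterTheta_add_two τ 1 0

@[simp] theorem quarterTheta_one_neg_two : quarterTheta τ 1 (-2) = -I * quarterTheta τ 1 0 := by
  have := quarterTheta_add_two τ 1 (-2)
  simp only [zpow_one, Int.reduceNeg, Int.reduceAdd] at this
  rw [this, ← mul_assoc, neg_mul, I_mul_I]; simp

@[simp] theorem quarterTheta_one_neg_one : quarterTheta τ 1 (-1) = -I * quarterTheta τ 1 1 := by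
  have := quarterTheta_add_two τ 1 (-1)
  simp only [zpow_one, Int.reduceNeg, Int.reduceAdd] at this
  rw [this, ← mul_assoc, neg_mul, I_mul_I]; simp

@[simp] theorem quarterTheta_three (b : ℤ) : quarterTheta τ 3 b = quarterTheta τ 1 (-b) := by
  rw [← quarterTheta_neg, ← quarterTheta_add_four]; rfl

@[simp] theorem quarterTheta_four (b : ℤ) : quarterTheta τ 4 b = quarterTheta τ 0 b := by
  rw [← quarterTheta_add_four τ 0]; rfl

@[simp] theorem quarterTheta_five (b : ℤ) : quarterTheta τ 5 b = quarterTheta τ 1 b := by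
  rw [← quarterTheta_add_four τ 1]; rfl

end Table

theorem prod_pi_fin_three_two {M : Type*} [CommMonoid M] (F : (Fin 3 → Fin 2) → M) :
    ∏ a, F a = ∏ x : Fin 2, ∏ y : Fin 2, ∏ z : Fin 2, F ![x, y, z] := by
  simp_rw [← Fintype.prod_prod_type']
  symm
  refine Fintype.prod_bijective (fun p : (Fin 2 × Fin 2) × Fin 2 => ![p.1.1, p.1.2, p.2])
    (by decide) _ _ fun p => rfl

/-- The product of the even theta constants with a given upper characteristic. -/
def chiPart (τ : Matrix (Fin 3) (Fin 3) ℂ) (a : Fin 3 → Fin 2) : ℂ :=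
  ∏ b : Fin 3 → Fin 2, if Even (∑ i, (a i : ℕ) * (b i : ℕ)) then
    thetaNull (fun i => ((a i : ℕ) : ℤ)) (fun i => ((b i : ℕ) : ℤ)) τ else 1

theorem chi_eq_prod_chiPart (τ : Matrix (Fin 3) (Fin 3) ℂ) : chi τ = ∏ a, chiPart τ a := by
  rw [chi, evenChars, Finset.prod_filter, Fintype.prod_prod_type]
  rfl

theorem chiPart_zero_zero_zero {τ : Fin 3 → ℂ} (hτ : ∀ i, 0 < (τ i).im)
    (hS : IsSiegel (isogenyMatrix τ)) : chiPart (isogenyMatrix τ) ![0, 0, 0] =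
    (θ₃ (2 * τ 0) ^ 2 * θ₃ (2 * τ 1) ^ 2 * θ₃ (2 * τ 2) ^ 2 -
      θ₂ (2 * τ 0) ^ 2 * θ₂ (2 * τ 1) ^ 2 * θ₂ (2 * τ 2) ^ 2) *
      (θ₃ (2 * τ 0) ^ 2 * θ₄ (2 * τ 1) ^ 2 * θ₄ (2 * τ 2) ^ 2) *
      (θ₄ (2 * τ 0) ^ 2 * θ₃ (2 * τ 1) ^ 2 * θ₄ (2 * τ 2) ^ 2) *
      (θ₄ (2 * τ 0) ^ 2 * θ₄ (2 * τ 1) ^ 2 * θ₃ (2 * τ 2) ^ 2) := by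
  simp only [chiPart, prod_pi_fin_three_two, Fin.prod_univ_two, thetaNull_isogenyMatrix hτ hS]
  simp [Fin.sum_univ_three]
  ring

theorem chiPart_zero_one_zero {τ : Fin 3 → ℂ} (hτ : ∀ i, 0 < (τ i).im)
    (hS : IsSiegel (isogenyMatrix τ)) : chiPart (isogenyMatrix τ) ![0, 1, 0] =
    (θ₃ (2 * τ 0) ^ 2 * θ₂ (2 * τ 1) ^ 2 * θ₃ (2 * τ 2) ^ 2 -
      θ₂ (2 * τ 0) ^ 2 * θ₃ (2 * τ 1) ^ 2 * θ₂ (2 * τ 2) ^ 2) *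
      (θ₄ (2 * τ 0) ^ 2 * θ₂ (2 * τ 1) ^ 2 * θ₄ (2 * τ 2) ^ 2) := by
  simp only [chiPart, prod_pi_fin_three_two, Fin.prod_univ_two, thetaNull_isogenyMatrix hτ hS]
  simp [Fin.sum_univ_three, Nat.even_iff]
  ring

theorem chiPart_one_zero_zero {τ : Fin 3 → ℂ} (hτ : ∀ i, 0 < (τ i).im)
    (hS : IsSiegel (isogenyMatrix τ)) : chiPart (isogenyMatrix τ) ![1, 0, 0] =
    (θ₂ (2 * τ 0) ^ 2 * θ₃ (2 * τ 1) ^ 2 * θ₃ (2 * τ 2) ^ 2 -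
      θ₃ (2 * τ 0) ^ 2 * θ₂ (2 * τ 1) ^ 2 * θ₂ (2 * τ 2) ^ 2) *
      (θ₂ (2 * τ 0) ^ 2 * θ₄ (2 * τ 1) ^ 2 * θ₄ (2 * τ 2) ^ 2) := by
  simp only [chiPart, prod_pi_fin_three_two, Fin.prod_univ_two, thetaNull_isogenyMatrix hτ hS]
  simp [Fin.sum_univ_three, Nat.even_iff]
  ring

theorem chiPart_one_one_zero {τ : Fin 3 → ℂ} (hτ : ∀ i, 0 < (τ i).im)
    (hS : IsSiegel (isogenyMatrix τ)) : chiPart (isogenyMatrix τ) ![1, 1, 0] =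
    (θ₃ (2 * τ 0) ^ 2 * θ₃ (2 * τ 1) ^ 2 * θ₂ (2 * τ 2) ^ 2 -
      θ₂ (2 * τ 0) ^ 2 * θ₂ (2 * τ 1) ^ 2 * θ₃ (2 * τ 2) ^ 2) *
      (θ₄ (2 * τ 0) ^ 2 * θ₄ (2 * τ 1) ^ 2 * θ₂ (2 * τ 2) ^ 2) := by
  simp only [chiPart, prod_pi_fin_three_two, Fin.prod_univ_two, thetaNull_isogenyMatrix hτ hS]
  simp [Fin.sum_univ_three, Nat.even_iff]
  ring

theorem chiPart_zero_zero_one {τ : Fin 3 → ℂ} (hτ : ∀ i, 0 < (τ i).im)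
    (hS : IsSiegel (isogenyMatrix τ)) : chiPart (isogenyMatrix τ) ![0, 0, 1] =
    16 * I * ∏ i, (quarterTheta (τ i) 1 0 ^ 2 * quarterTheta (τ i) 1 1 ^ 2) := by
  simp only [chiPart, prod_pi_fin_three_two, Fin.prod_univ_two, thetaNull_isogenyMatrix hτ hS]
  simp [Fin.sum_univ_three, Nat.even_iff]
  simp only [Fin.prod_univ_three]
  have hI : I ^ 3 = -I := I_pow_three
  linear_combination 8 * (I ^ 2 - 2) *
    (quarterTheta (τ 0) 1 0 ^ 2 * quarterTheta (τ 0) 1 1 ^ 2 *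
    (quarterTheta (τ 1) 1 0 ^ 2 * quarterTheta (τ 1) 1 1 ^ 2) *
    (quarterTheta (τ 2) 1 0 ^ 2 * quarterTheta (τ 2) 1 1 ^ 2)) * hI

theorem chiPart_zero_one_one {τ : Fin 3 → ℂ} (hτ : ∀ i, 0 < (τ i).im)
    (hS : IsSiegel (isogenyMatrix τ)) : chiPart (isogenyMatrix τ) ![0, 1, 1] =
    16 * I * ∏ i, (quarterTheta (τ i) 1 0 ^ 2 * quarterTheta (τ i) 1 1 ^ 2) := by
  simp only [chiPart, prod_pi_fin_three_two, Fin.prod_univ_two, thetaNull_isogenyMatrix hτ hS]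
  simp [Fin.sum_univ_three, Nat.even_iff]
  simp only [Fin.prod_univ_three]
  have hI : I ^ 3 = -I := I_pow_three
  linear_combination -16 *
    (quarterTheta (τ 0) 1 0 ^ 2 * quarterTheta (τ 0) 1 1 ^ 2 *
    (quarterTheta (τ 1) 1 0 ^ 2 * quarterTheta (τ 1) 1 1 ^ 2) *
    (quarterTheta (τ 2) 1 0 ^ 2 * quarterTheta (τ 2) 1 1 ^ 2)) * hI

theorem chiPart_one_zero_one {τ : Fin 3 → ℂ} (hτ : ∀ i, 0 < (τ i).im)
    (hS : IsSiegel (isogenyMatrix τ)) : chiPart (isogenyMatrix τ) ![1, 0, 1] =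
    16 * I * ∏ i, (quarterTheta (τ i) 1 0 ^ 2 * quarterTheta (τ i) 1 1 ^ 2) := by
  simp only [chiPart, prod_pi_fin_three_two, Fin.prod_univ_two, thetaNull_isogenyMatrix hτ hS]
  simp [Fin.sum_univ_three, Nat.even_iff]
  simp only [Fin.prod_univ_three]
  have hI : I ^ 3 = -I := I_pow_three
  linear_combination -16 *
    (quarterTheta (τ 0) 1 0 ^ 2 * quarterTheta (τ 0) 1 1 ^ 2 *
    (quarterTheta (τ 1) 1 0 ^ 2 * quarterTheta (τ 1) 1 1 ^ 2) *
    (quarterTheta (τ 2) 1 0 ^ 2 * quarterTheta (τ 2) 1 1 ^ 2)) * hI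

theorem chiPart_one_one_one {τ : Fin 3 → ℂ} (hτ : ∀ i, 0 < (τ i).im)
    (hS : IsSiegel (isogenyMatrix τ)) : chiPart (isogenyMatrix τ) ![1, 1, 1] =
    -16 * I * ∏ i, (quarterTheta (τ i) 1 0 ^ 2 * quarterTheta (τ i) 1 1 ^ 2) := by
  simp only [chiPart, prod_pi_fin_three_two, Fin.prod_univ_two, thetaNull_isogenyMatrix hτ hS]
  simp [Fin.sum_univ_three, Nat.even_iff]
  simp only [Fin.prod_univ_three]
  have hI : I ^ 3 = -I := I_pow_three
  linear_combination -8 * (I ^ 2 - 2) *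
    (quarterTheta (τ 0) 1 0 ^ 2 * quarterTheta (τ 0) 1 1 ^ 2 *
    (quarterTheta (τ 1) 1 0 ^ 2 * quarterTheta (τ 1) 1 1 ^ 2) *
    (quarterTheta (τ 2) 1 0 ^ 2 * quarterTheta (τ 2) 1 1 ^ 2)) * hI

/-- The product of the even theta constants of the isogenous threefold, in terms of the theta
series at `2 τ`: the sixteen characteristics with `ε₁ 2 = 1` give monomials, the other twenty give
monomials and four differences of squares. -/
theorem chi_isogenyMatrix_eq_two_mul {τ : Fin 3 → ℂ} (hτ : ∀ i, 0 < (τ i).im)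
    (hS : IsSiegel (isogenyMatrix τ)) :
    chi (isogenyMatrix τ) = -(2 ^ 16) *
      ((θ₃ (2 * τ 0) ^ 2 * θ₃ (2 * τ 1) ^ 2 * θ₃ (2 * τ 2) ^ 2 -
          θ₂ (2 * τ 0) ^ 2 * θ₂ (2 * τ 1) ^ 2 * θ₂ (2 * τ 2) ^ 2) *
        (θ₃ (2 * τ 0) ^ 2 * θ₂ (2 * τ 1) ^ 2 * θ₃ (2 * τ 2) ^ 2 -
          θ₂ (2 * τ 0) ^ 2 * θ₃ (2 * τ 1) ^ 2 * θ₂ (2 * τ 2) ^ 2) *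
        (θ₂ (2 * τ 0) ^ 2 * θ₃ (2 * τ 1) ^ 2 * θ₃ (2 * τ 2) ^ 2 -
          θ₃ (2 * τ 0) ^ 2 * θ₂ (2 * τ 1) ^ 2 * θ₂ (2 * τ 2) ^ 2) *
        (θ₃ (2 * τ 0) ^ 2 * θ₃ (2 * τ 1) ^ 2 * θ₂ (2 * τ 2) ^ 2 -
          θ₂ (2 * τ 0) ^ 2 * θ₂ (2 * τ 1) ^ 2 * θ₃ (2 * τ 2) ^ 2)) *
      (∏ i, (θ₂ (2 * τ i) ^ 2 * θ₃ (2 * τ i) ^ 2) * (θ₄ (2 * τ i) ^ 2) ^ 4) *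
      ∏ i, (quarterTheta (τ i) 1 0 ^ 2) ^ 4 * (quarterTheta (τ i) 1 1 ^ 2) ^ 4 := by
  simp only [chi_eq_prod_chiPart, prod_pi_fin_three_two, Fin.prod_univ_two,
    chiPart_zero_zero_zero hτ hS, chiPart_zero_one_zero hτ hS, chiPart_one_zero_zero hτ hS,
    chiPart_one_one_zero hτ hS, chiPart_zero_zero_one hτ hS, chiPart_zero_one_one hτ hS,
    chiPart_one_zero_one hτ hS, chiPart_one_one_one hτ hS, Fin.prod_univ_three]
  generalize θ₃ (2 * τ 0) ^ 2 * θ₃ (2 * τ 1) ^ 2 * θ₃ (2 * τ 2) ^ 2 -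
    θ₂ (2 * τ 0) ^ 2 * θ₂ (2 * τ 1) ^ 2 * θ₂ (2 * τ 2) ^ 2 = A
  generalize θ₃ (2 * τ 0) ^ 2 * θ₂ (2 * τ 1) ^ 2 * θ₃ (2 * τ 2) ^ 2 -
    θ₂ (2 * τ 0) ^ 2 * θ₃ (2 * τ 1) ^ 2 * θ₂ (2 * τ 2) ^ 2 = B
  generalize θ₂ (2 * τ 0) ^ 2 * θ₃ (2 * τ 1) ^ 2 * θ₃ (2 * τ 2) ^ 2 -
    θ₃ (2 * τ 0) ^ 2 * θ₂ (2 * τ 1) ^ 2 * θ₂ (2 * τ 2) ^ 2 = C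
  generalize θ₃ (2 * τ 0) ^ 2 * θ₃ (2 * τ 1) ^ 2 * θ₂ (2 * τ 2) ^ 2 -
    θ₂ (2 * τ 0) ^ 2 * θ₂ (2 * τ 1) ^ 2 * θ₃ (2 * τ 2) ^ 2 = D
  ring_nf
  rw [I_pow_four]
  ring

/-- The product of the even theta constants of the isogenous threefold, in terms of the theta
constants of the three curves. -/
theorem chi_isogenyMatrix {τ : Fin 3 → ℂ} (hτ : ∀ i, 0 < (τ i).im)
    (hS : IsSiegel (isogenyMatrix τ)) :
    chi (isogenyMatrix τ) = -(1 / 2 ^ 24) * (∏ i, θ₂ (τ i) ^ 12 * θ₃ (τ i) ^ 8 * θ₄ (τ i) ^ 8) *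
      ((∏ i, θ₂ (τ i) ^ 4) ^ 2 + 2 * (∏ i, (θ₃ (τ i) ^ 4 + θ₄ (τ i) ^ 4)) * (∏ i, θ₂ (τ i) ^ 4)
        - ((θ₃ (τ 0) ^ 4 + θ₄ (τ 0) ^ 4) * θ₂ (τ 1) ^ 4 * θ₂ (τ 2) ^ 4) ^ 2
        - ((θ₃ (τ 1) ^ 4 + θ₄ (τ 1) ^ 4) * θ₂ (τ 0) ^ 4 * θ₂ (τ 2) ^ 4) ^ 2
        - ((θ₃ (τ 2) ^ 4 + θ₄ (τ 2) ^ 4) * θ₂ (τ 0) ^ 4 * θ₂ (τ 1) ^ 4) ^ 2) := by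
  have hh : ∀ i, quarterTheta (τ i) 1 0 ^ 2 = θ₂ (τ i) * θ₃ (τ i) / 2 := fun i => by
    have := thetaSum_quarter_zero_sq (hτ i)
    simpa [quarterTheta] using this
  have hk : ∀ i, quarterTheta (τ i) 1 1 ^ 2 = I * (θ₂ (τ i) * θ₄ (τ i)) / 2 := fun i => by
    have := thetaSum_quarter_one_sq (hτ i)
    simpa [quarterTheta] using this
  have ht : ∀ i, θ₂ (τ i) ^ 4 = θ₃ (τ i) ^ 4 - θ₄ (τ i) ^ 4 := fun i => by
    rw [θ₃_pow_four (hτ i)]; ring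
  have hpq : ∀ i, θ₂ (2 * τ i) ^ 2 * θ₃ (2 * τ i) ^ 2 = θ₂ (τ i) ^ 4 / 4 := fun i => by
    rw [← mul_pow, θ₂_mul_θ₃_two_mul (hτ i)]; ring
  have hr : ∀ i, θ₄ (2 * τ i) ^ 2 = θ₃ (τ i) * θ₄ (τ i) := fun i => θ₄_two_mul_sq (hτ i)
  -- The product of the four differences, where `a, b, c, d, e, f` stand for the squares of `θ₃` and
  -- `θ₄` at `τ 0, τ 1, τ 2`.
  have hF : ∀ a b c d e f : ℂ,
      ((a + b) / 2 * ((c + d) / 2) * ((e + f) / 2) - (a - b) / 2 * ((c - d) / 2) * ((e - f) / 2)) *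
      ((a + b) / 2 * ((c - d) / 2) * ((e + f) / 2) - (a - b) / 2 * ((c + d) / 2) * ((e - f) / 2)) *
      ((a - b) / 2 * ((c + d) / 2) * ((e + f) / 2) - (a + b) / 2 * ((c - d) / 2) * ((e - f) / 2)) *
      ((a + b) / 2 * ((c + d) / 2) * ((e - f) / 2) - (a - b) / 2 * ((c - d) / 2) * ((e + f) / 2))
      = 1 / 2 ^ 10 * (((a ^ 2 - b ^ 2) * (c ^ 2 - d ^ 2) * (e ^ 2 - f ^ 2)) ^ 2 +
        2 * ((a ^ 2 + b ^ 2) * (c ^ 2 + d ^ 2) * (e ^ 2 + f ^ 2)) *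
          ((a ^ 2 - b ^ 2) * (c ^ 2 - d ^ 2) * (e ^ 2 - f ^ 2))
        - ((a ^ 2 + b ^ 2) * (c ^ 2 - d ^ 2) * (e ^ 2 - f ^ 2)) ^ 2
        - ((c ^ 2 + d ^ 2) * (a ^ 2 - b ^ 2) * (e ^ 2 - f ^ 2)) ^ 2
        - ((e ^ 2 + f ^ 2) * (a ^ 2 - b ^ 2) * (c ^ 2 - d ^ 2)) ^ 2) := by
    intros; ring
  have hF' := hF (θ₃ (τ 0) ^ 2) (θ₄ (τ 0) ^ 2) (θ₃ (τ 1) ^ 2) (θ₄ (τ 1) ^ 2) (θ₃ (τ 2) ^ 2)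
    (θ₄ (τ 2) ^ 2)
  simp only [← θ₃_two_mul_sq (hτ _), ← θ₂_two_mul_sq (hτ _), ← pow_mul, Nat.reduceMul, ← ht] at hF'
  have h4 : I ^ 4 = 1 := I_pow_four
  rw [chi_isogenyMatrix_eq_two_mul hτ hS, hF']
  simp only [hh, hk, hpq, hr, Fin.prod_univ_three, div_pow, mul_pow, h4]
  ring

end Isogeny

/-! ### Theta constants of products of elliptic curves -/

section Products

open scoped Real

theorem thetaNull_diagonal {g : ℕ} {τ : Fin g → ℂ} (hτ : ∀ i, 0 < (τ i).im)
    (ε₁ ε₂ : Fin g → ℤ) :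
    thetaNull ε₁ ε₂ (diagonal τ) = ∏ i, thetaSum (τ i) ((ε₁ i : ℂ) / 2) (ε₂ i) := by
  simp only [thetaNull_eq, thetaSum]
  rw [← (tsum_pi_prod _ fun i => (summable_thetaSum (hτ i) _ _).norm).2]
  refine tsum_congr fun m => ?_
  rw [← Complex.exp_sum, thetaTerm]
  congr 1
  simp only [dotProduct, mulVec_diagonal, ← Finset.mul_sum, ← Finset.sum_add_distrib]
  congr 1
  refine Finset.sum_congr rfl fun i _ => ?_
  ring

theorem riemannMatrix_fromCols_diagonal {g : ℕ} {ω₁ ω₂ : Fin g → ℂ} (h : ∀ i, ω₂ i ≠ 0) :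
    riemannMatrix (fromCols (diagonal ω₁) (diagonal ω₂)) = diagonal fun i => ω₁ i / ω₂ i := by
  have hu : IsUnit (diagonal ω₂).det := by
    rw [det_diagonal, isUnit_iff_ne_zero]
    exact Finset.prod_ne_zero_iff.2 fun i _ => h i
  have e : diagonal ω₁ = diagonal ω₂ * diagonal fun i => ω₁ i / ω₂ i := by
    rw [diagonal_mul_diagonal]
    congr 1; ext i
    rw [mul_div_cancel₀ _ (h i)]
  rw [riemannMatrix, toCols₁_fromCols, toCols₂_fromCols, e, ← Matrix.mul_assoc,
    nonsing_inv_mul _ hu, Matrix.one_mul]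

theorem pairMatrix_eq (w₁ w₂ : ℂ) : pairMatrix w₁ w₂
    = fromCols (diagonal fun _ : Fin 1 => w₁) (diagonal fun _ : Fin 1 => w₂) := by
  rw [pairMatrix]
  congr 1 <;> ext i j <;> fin_cases i <;> fin_cases j <;> simp

theorem ne_zero_and_im_pos_of_mem {w₁ w₂ : ℂ} (h : pairMatrix w₁ w₂ ∈ periodMatrices 1) :
    w₂ ≠ 0 ∧ 0 < (w₁ / w₂).im := by
  have hR : IsRiemann (pairMatrix w₁ w₂) := h.2
  have h2 : w₂ ≠ 0 := by
    have := hR.isUnit_det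
    simpa [pairMatrix] using this
  have h3 := hR.isSiegel.im_diag_pos 0
  rw [pairMatrix_eq, riemannMatrix_fromCols_diagonal fun _ => h2] at h3
  exact ⟨h2, by simpa using h3⟩

theorem thetaRoot_zero {w₁ w₂ : ℂ} (h2 : w₂ ≠ 0) (h : 0 < (w₁ / w₂).im) :
    thetaRoot w₁ w₂ 0 = π ^ 2 / w₂ ^ 2 * θ₃ (w₁ / w₂) ^ 4 := by
  rw [thetaRoot, pairMatrix_eq, riemannMatrix_fromCols_diagonal fun _ => h2,
    thetaNull_diagonal fun _ => h]
  simp [θ₃]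

theorem thetaRoot_one {w₁ w₂ : ℂ} (h2 : w₂ ≠ 0) (h : 0 < (w₁ / w₂).im) :
    thetaRoot w₁ w₂ 1 = π ^ 2 / w₂ ^ 2 * θ₄ (w₁ / w₂) ^ 4 := by
  rw [thetaRoot, pairMatrix_eq, riemannMatrix_fromCols_diagonal fun _ => h2,
    thetaNull_diagonal fun _ => h]
  simp [θ₄]

end Products

/-! ### The symmetric matrix of a triple of curves -/

section Triple

open scoped Real

theorem CurveTriple.isElliptic_curve {t : CurveTriple} {i : Fin 3} (hc : t.c i ≠ 0)
    (hδ : t.δ i ≠ 0) : (t.curve i).IsElliptic := by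
  refine ⟨isUnit_iff_ne_zero.2 ?_⟩
  have : (t.curve i).Δ = 2 ^ 12 * t.c i ^ 2 * t.δ i := by
    simp only [WeierstrassCurve.Δ, WeierstrassCurve.b₂, WeierstrassCurve.b₄, WeierstrassCurve.b₆,
      WeierstrassCurve.b₈, CurveTriple.curve, CurveTriple.δ]
    ring
  rw [this]
  exact mul_ne_zero (mul_ne_zero (by norm_num) (pow_ne_zero _ hc)) hδ

/-- If `δ i = (r i)²` and `ρ = -r₀r₁r₂`, the `i`-th diagonal cofactor is `c i`. -/
theorem CurveTriple.adjugate_mat {t : CurveTriple} {r : Fin 3 → ℂ} (hr : ∀ i, r i ≠ 0)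
    (hδ : ∀ i, t.δ i = r i ^ 2) (hρ : t.ρ = -∏ i, r i) (i : Fin 3) :
    t.Mat.adjugate i i = t.c i := by
  have hc : t.c i = r i ^ 2 - t.b i ^ 2 := by rw [← hδ, CurveTriple.δ]; ring
  have h0 := hr 0
  have h1 := hr 1
  have h2 := hr 2
  rw [hc, CurveTriple.Mat, adjugate_fin_three_of]
  simp only [hδ, hρ, Fin.prod_univ_three]
  fin_cases i <;> simp <;> field_simp

theorem CurveTriple.prod_mat {t : CurveTriple} {r : Fin 3 → ℂ} (hr : ∀ i, r i ≠ 0)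
    (hδ : ∀ i, t.δ i = r i ^ 2) (hρ : t.ρ = -∏ i, r i) :
    ∏ i, t.Mat i i = -∏ i, r i := by
  have h0 := hr 0
  have h1 := hr 1
  have h2 := hr 2
  simp [CurveTriple.Mat, hδ, hρ, Fin.prod_univ_three]
  field_simp

theorem CurveTriple.X_mat {t : CurveTriple} {r : Fin 3 → ℂ} (hr : ∀ i, r i ≠ 0)
    (hδ : ∀ i, t.δ i = r i ^ 2) (hρ : t.ρ = -∏ i, r i) :
    X t.Mat = (∏ i, r i) ^ 3 * (∏ i, t.c i) ^ 2 *
      (-(∏ i, r i) ^ 2 + 2 * (∏ i, t.b i) * (∏ i, r i)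
        + (t.b 0 * r 1 * r 2) ^ 2 + (t.b 1 * r 0 * r 2) ^ 2 + (t.b 2 * r 0 * r 1) ^ 2) := by
  have h0 := hr 0
  have h1 := hr 1
  have h2 := hr 2
  have hdet : t.Mat.det * ∏ i, r i = -(∏ i, r i) ^ 2 + 2 * (∏ i, t.b i) * (∏ i, r i)
        + (t.b 0 * r 1 * r 2) ^ 2 + (t.b 1 * r 0 * r 2) ^ 2 + (t.b 2 * r 0 * r 1) ^ 2 := by
    rw [CurveTriple.Mat, det_fin_three]
    simp [hδ, hρ, Fin.prod_univ_three]
    field_simp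
    ring
  rw [X, CurveTriple.prod_mat hr hδ hρ, ← hdet]
  simp only [CurveTriple.adjugate_mat hr hδ hρ]
  ring

variable {ω₁ ω₂ : Fin 3 → ℂ}

theorem det_toCols₂_diagPeriod : (diagPeriod ω₁ ω₂).toCols₂.det = ∏ i, ω₂ i := by
  rw [diagPeriod, toCols₂_fromCols, det_diagonal]

theorem curveTriple_ρ (h2 : ∀ i, ω₂ i ≠ 0) (h : ∀ i, 0 < (ω₁ i / ω₂ i).im) :
    (curveTriple ω₁ ω₂).ρ = -∏ i, (π ^ 2 / (4 * ω₂ i ^ 2) * θ₂ (ω₁ i / ω₂ i) ^ 4) := by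
  simp only [curveTriple]
  rw [det_toCols₂_diagPeriod, diagPeriod, riemannMatrix_fromCols_diagonal h2,
    thetaNull_diagonal h]
  have := h2 0
  have := h2 1
  have := h2 2
  simp [θ₂, Fin.prod_univ_three]
  field_simp
  ring

theorem curveTriple_b (h2 : ∀ i, ω₂ i ≠ 0) (h : ∀ i, 0 < (ω₁ i / ω₂ i).im) (i : Fin 3) :
    (curveTriple ω₁ ω₂).b i
      = -(π ^ 2 / (4 * ω₂ i ^ 2)) * (θ₃ (ω₁ i / ω₂ i) ^ 4 + θ₄ (ω₁ i / ω₂ i) ^ 4) := by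
  simp only [curveTriple]
  rw [thetaRoot_zero (h2 i) (h i), thetaRoot_one (h2 i) (h i)]
  have := h2 i
  field_simp

theorem curveTriple_c (h2 : ∀ i, ω₂ i ≠ 0) (h : ∀ i, 0 < (ω₁ i / ω₂ i).im) (i : Fin 3) :
    (curveTriple ω₁ ω₂).c i
      = -(π ^ 4 / (4 * ω₂ i ^ 4)) * (θ₃ (ω₁ i / ω₂ i) ^ 4 * θ₄ (ω₁ i / ω₂ i) ^ 4) := by
  simp only [curveTriple]
  rw [thetaRoot_zero (h2 i) (h i), thetaRoot_one (h2 i) (h i)]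
  have := h2 i
  field_simp

/-- By Jacobi's identity, `δ i` is a square. -/
theorem curveTriple_δ (h2 : ∀ i, ω₂ i ≠ 0) (h : ∀ i, 0 < (ω₁ i / ω₂ i).im) (i : Fin 3) :
    (curveTriple ω₁ ω₂).δ i = (π ^ 2 / (4 * ω₂ i ^ 2) * θ₂ (ω₁ i / ω₂ i) ^ 4) ^ 2 := by
  have ht : θ₂ (ω₁ i / ω₂ i) ^ 4 = θ₃ (ω₁ i / ω₂ i) ^ 4 - θ₄ (ω₁ i / ω₂ i) ^ 4 := by
    rw [θ₃_pow_four (h i)]; ring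
  rw [CurveTriple.δ, curveTriple_b h2 h, curveTriple_c h2 h, ht]
  have := h2 i
  field_simp
  ring

theorem ρ_factor_ne_zero (h2 : ∀ i, ω₂ i ≠ 0) (h : ∀ i, 0 < (ω₁ i / ω₂ i).im) (i : Fin 3) :
    (π : ℂ) ^ 2 / (4 * ω₂ i ^ 2) * θ₂ (ω₁ i / ω₂ i) ^ 4 ≠ 0 := by
  have := h2 i
  have := θ₂_ne_zero (h i)
  have : (π : ℂ) ≠ 0 := by exact_mod_cast Real.pi_ne_zero
  positivity

theorem curveTriple_c_ne_zero (h2 : ∀ i, ω₂ i ≠ 0) (h : ∀ i, 0 < (ω₁ i / ω₂ i).im)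
    (i : Fin 3) : (curveTriple ω₁ ω₂).c i ≠ 0 := by
  rw [curveTriple_c h2 h]
  have := h2 i
  have := θ₃_ne_zero (h i)
  have := θ₄_ne_zero (h i)
  have : (π : ℂ) ≠ 0 := by exact_mod_cast Real.pi_ne_zero
  simp_all

theorem curveTriple_mem_markedTriples (h2 : ∀ i, ω₂ i ≠ 0) (h : ∀ i, 0 < (ω₁ i / ω₂ i).im) :
    curveTriple ω₁ ω₂ ∈ markedTriples := by
  refine ⟨fun i => CurveTriple.isElliptic_curve (curveTriple_c_ne_zero h2 h i) ?_, ?_, ?_⟩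
  · rw [curveTriple_δ h2 h]
    exact pow_ne_zero _ (ρ_factor_ne_zero h2 h i)
  · rw [curveTriple_ρ h2 h, neg_ne_zero]
    exact Finset.prod_ne_zero_iff.2 fun i _ => ρ_factor_ne_zero h2 h i
  · rw [curveTriple_ρ h2 h, neg_sq, ← Finset.prod_pow]
    exact Finset.prod_congr rfl fun i _ => (curveTriple_δ h2 h i).symm

theorem mat_curveTriple_mem_S (h2 : ∀ i, ω₂ i ≠ 0) (h : ∀ i, 0 < (ω₁ i / ω₂ i).im) :
    (curveTriple ω₁ ω₂).Mat ∈ S := by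
  refine ⟨?_, ?_, ?_⟩
  · ext i j
    fin_cases i <;> fin_cases j <;> simp [CurveTriple.Mat]
  · rw [CurveTriple.prod_mat (ρ_factor_ne_zero h2 h) (curveTriple_δ h2 h) (curveTriple_ρ h2 h),
      neg_ne_zero]
    exact Finset.prod_ne_zero_iff.2 fun i _ => ρ_factor_ne_zero h2 h i
  · refine Finset.prod_ne_zero_iff.2 fun i _ => ?_
    rw [CurveTriple.adjugate_mat (ρ_factor_ne_zero h2 h) (curveTriple_δ h2 h)
      (curveTriple_ρ h2 h)]
    exact curveTriple_c_ne_zero h2 h i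

/-- Both sides are the same polynomial in the theta constants of the three curves. -/
theorem X_mat_curveTriple (h2 : ∀ i, ω₂ i ≠ 0) (h : ∀ i, 0 < (ω₁ i / ω₂ i).im)
    (hS : IsSiegel (isogenyMatrix fun i => ω₁ i / ω₂ i)) :
    X (curveTriple ω₁ ω₂).Mat
      = (π / 2) ^ 54 * ((∏ i, ω₂ i) / 4 : ℂ)⁻¹ ^ 18 *
        chi (isogenyMatrix fun i => ω₁ i / ω₂ i) := by
  rw [CurveTriple.X_mat (ρ_factor_ne_zero h2 h) (curveTriple_δ h2 h) (curveTriple_ρ h2 h),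
    chi_isogenyMatrix h hS]
  simp only [curveTriple_b h2 h, curveTriple_c h2 h, Fin.prod_univ_three]
  have := h2 0
  have := h2 1
  have := h2 2
  field_simp
  ring

end Triple

/-! ### Comparison of period matrices of one polarized torus -/

section Comparison

theorem exists_eq_mul_toComplex {g : ℕ} {Ω Ω' : PMat g} (h : lattice Ω' ≤ lattice Ω) :
    ∃ M : Matrix (Fin g ⊕ Fin g) (Fin g ⊕ Fin g) ℤ, Ω' = Ω * toComplex M := by
  have h1 : ∀ j, ∃ c : Fin g ⊕ Fin g → ℤ, ∑ k, c k • (fun i => Ω i k) = fun i => Ω' i j := by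
    intro j
    have h2 : (fun i => Ω' i j) ∈ lattice Ω := h (AddSubgroup.subset_closure ⟨j, rfl⟩)
    rw [lattice, ← Submodule.span_int_eq_addSubgroupClosure] at h2
    exact (Submodule.mem_span_range_iff_exists_fun ℤ).1 h2
  choose c hc using h1
  refine ⟨of fun k j => c j k, ?_⟩
  ext i j
  have := congrFun (hc j) i
  simp only [Finset.sum_apply, zsmul_eq_mul] at this
  rw [← this, Matrix.mul_apply]
  simp [mul_comm]

theorem IsRiemann.pairing_congr {g : ℕ} {Ω Ω' : PMat g} (h : IsRiemann Ω) (h' : IsRiemann Ω')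
    (hp : polarization Ω' = polarization Ω) : pairing Ω' = pairing Ω := by
  have h2 : (2 * I : ℂ) ≠ 0 := by simp
  have h1 : (pairing Ω')⁻¹ = (pairing Ω)⁻¹ := smul_right_injective _ h2 hp
  rw [← nonsing_inv_nonsing_inv _ h'.posDef_pairing.2, h1,
    nonsing_inv_nonsing_inv _ h.posDef_pairing.2]

/-- Two period matrices with the same polarization and with `Ω' = Ω M`, for `M` integral, differ
by a symplectic matrix: `M J ᵗM - J` is orthogonal to the rows of `Ω` and of its conjugate, which
together form an invertible matrix. -/
theorem IsRiemann.mem_symplecticGroup {g : ℕ} {Ω : PMat g} (h : IsRiemann Ω)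
    {M : Matrix (Fin g ⊕ Fin g) (Fin g ⊕ Fin g) ℤ} (h' : IsRiemann (Ω * toComplex M))
    (hp : polarization (Ω * toComplex M) = polarization Ω) :
    M ∈ symplecticGroup (Fin g) ℤ := by
  set J := Matrix.J (Fin g) ℂ with hJ
  set N := toComplex M * J * (toComplex M).transpose - J with hN
  have hpair := h.pairing_congr h' hp
  have hu := h.posDef_pairing.2
  have conj_mul : ∀ {l m n : Type} [Fintype m] (A : Matrix l m ℂ) (B : Matrix m n ℂ),
      (A * B).map (starRingEnd ℂ) = A.map (starRingEnd ℂ) * B.map (starRingEnd ℂ) :=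
    fun A B => Matrix.map_mul
  have conj_conj : ∀ {l m : Type} (A : Matrix l m ℂ),
      (A.map (starRingEnd ℂ)).map (starRingEnd ℂ) = A := fun A => by ext; simp
  have conj_M : (toComplex M).map (starRingEnd ℂ) = toComplex M := by ext; simp
  have conj_J : J.map (starRingEnd ℂ) = J := Matrix.map_J _ _
  have conj_N : N.map (starRingEnd ℂ) = N := by
    rw [hN, Matrix.map_sub _ (map_sub _), conj_mul, conj_mul, transpose_map, conj_M, conj_J]
  set Ωc := Ω.map (starRingEnd ℂ) with hΩc
  have e1 : Ω * J * Ω.transpose = 0 := by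
    simpa [stdJ_eq] using h.1
  have e2 : Ω * (toComplex M * J * (toComplex M).transpose) * Ω.transpose = 0 := by
    have := h'.1
    simp only [stdJ_eq, transpose_mul, Matrix.mul_neg, Matrix.neg_mul, neg_eq_zero] at this
    simpa only [Matrix.mul_assoc] using this
  have e3 : Ωc * (toComplex M * J * (toComplex M).transpose) * Ω.transpose
      = Ωc * J * Ω.transpose := by
    rw [pairing, pairing, stdJ_inv, conj_mul, conj_M, transpose_mul] at hpair
    simpa only [Matrix.mul_assoc] using hpair
  have f1 : Ω * N * Ω.transpose = 0 := by
    rw [hN, Matrix.mul_sub, Matrix.sub_mul, e1, e2, sub_zero]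
  have f2 : Ωc * N * Ω.transpose = 0 := by
    rw [hN, Matrix.mul_sub, Matrix.sub_mul, e3, sub_self]
  have f3 : Ωc * N * Ωc.transpose = 0 := by
    have := congrArg (fun A => A.map (starRingEnd ℂ)) f1
    simpa [conj_mul, conj_N, transpose_map, hΩc] using this
  have f4 : Ω * N * Ωc.transpose = 0 := by
    have := congrArg (fun A => A.map (starRingEnd ℂ)) f2
    simpa [conj_mul, conj_N, transpose_map, hΩc, conj_conj] using this
  have e4 : Ωc * J * Ωc.transpose = 0 := by
    have := congrArg (fun A => A.map (starRingEnd ℂ)) e1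
    simpa [conj_mul, conj_J, transpose_map, hΩc] using this
  have hP : Ωc * J * Ω.transpose = pairing Ω := by rw [pairing, stdJ_inv]
  set P := pairing Ω with hPdef
  have hPc : Ω * J * Ωc.transpose = P.map (starRingEnd ℂ) := by
    rw [← hP, conj_mul, conj_mul, conj_J, conj_conj, transpose_map]
  have huc : IsUnit (P.map (starRingEnd ℂ)).det := by
    have : (P.map (starRingEnd ℂ)).det = starRingEnd ℂ P.det :=
      (RingHom.map_det (starRingEnd ℂ) P).symm
    rw [this]; exact hu.map _
  set C := fromRows Ω Ωc with hC
  have hCJ : C * J * C.transpose = fromBlocks 0 (P.map (starRingEnd ℂ)) P 0 := by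
    rw [hC, transpose_fromRows, fromRows_mul, fromRows_mul_fromCols, e1, hP, hPc, e4]
  have hCN : C * N * C.transpose = 0 := by
    rw [hC, transpose_fromRows, fromRows_mul, fromRows_mul_fromCols, f1, f2, f3, f4,
      fromBlocks_zero]
  have hCu : IsUnit C.det := by
    have h1 : C * (J * C.transpose * fromBlocks 0 P⁻¹ (P.map (starRingEnd ℂ))⁻¹ 0) = 1 := by
      rw [← Matrix.mul_assoc, ← Matrix.mul_assoc, hCJ, fromBlocks_multiply]
      simp [mul_nonsing_inv _ hu, mul_nonsing_inv _ huc]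
    exact isUnit_det_of_right_inverse h1
  have hN0 : N = 0 := by
    have h1 : C * N = 0 := by
      have := congrArg (fun A => A * C.transpose⁻¹) hCN
      simpa [Matrix.mul_assoc, mul_nonsing_inv _ (show IsUnit C.transpose.det by
        rwa [det_transpose])] using this
    have := congrArg (fun A => C⁻¹ * A) h1
    simpa [← Matrix.mul_assoc, nonsing_inv_mul _ hCu] using this
  rw [SymplecticGroup.mem_iff]
  have hinj : Function.Injective (toComplex (m := Fin g ⊕ Fin g) (n := Fin g ⊕ Fin g)) :=
    Matrix.map_injective (RingHom.injective_int _)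
  apply hinj
  simp only [toComplex, Matrix.map_mul, Matrix.map_J]
  exact sub_eq_zero.1 hN0

/-- `χ₁₈` depends on the polarized torus only. The inclusion of the lattices suffices, because the
polarizations agree. -/
theorem chi18_eq_of_lattice_le {Ω Ω' : PMat 3} (h : IsRiemann Ω) (h' : IsRiemann Ω')
    (hp : polarization Ω' = polarization Ω) (hl : lattice Ω' ≤ lattice Ω) :
    chi18 Ω' = chi18 Ω := by
  obtain ⟨M, rfl⟩ := exists_eq_mul_toComplex hl
  exact chi18_mul_symplectic h (h.mem_symplecticGroup h' hp)

end Comparison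

/-! ### A period matrix of the quotient by `W` -/

section Quotient

variable {ω₁ ω₂ : Fin 3 → ℂ}

/-- A period matrix of the quotient by `W`. With `e` the standard basis, its columns are
`ω₁ e₀, ω₁ e₁, ω₁ (e₀ + e₁ + e₂) / 2` and `ω₂ (e₀ - e₂) / 2, ω₂ (e₁ - e₂) / 2, ω₂ e₂`. -/
def quotientPeriod (ω₁ ω₂ : Fin 3 → ℂ) : PMat 3 :=
  fromCols (diagonal ω₁ * !![1, 0, 1 / 2; 0, 1, 1 / 2; 0, 0, 1 / 2])
    (diagonal ω₂ * !![1 / 2, 0, 0; 0, 1 / 2, 0; -1 / 2, -1 / 2, 1])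

/-- The columns of `quotientPeriod ω₁ ω₂`. -/
theorem mem_lattice_quotientPeriod :
    ![ω₁ 0, 0, 0] ∈ lattice (quotientPeriod ω₁ ω₂) ∧
    ![0, ω₁ 1, 0] ∈ lattice (quotientPeriod ω₁ ω₂) ∧
    ![ω₁ 0 / 2, ω₁ 1 / 2, ω₁ 2 / 2] ∈ lattice (quotientPeriod ω₁ ω₂) ∧
    ![ω₂ 0 / 2, 0, -ω₂ 2 / 2] ∈ lattice (quotientPeriod ω₁ ω₂) ∧
    ![0, ω₂ 1 / 2, -ω₂ 2 / 2] ∈ lattice (quotientPeriod ω₁ ω₂) ∧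
    ![0, 0, ω₂ 2] ∈ lattice (quotientPeriod ω₁ ω₂) := by
  have hmem : ∀ j, (fun i => quotientPeriod ω₁ ω₂ i j) ∈ lattice (quotientPeriod ω₁ ω₂) :=
    fun j => AddSubgroup.subset_closure ⟨j, rfl⟩
  refine ⟨?_, ?_, ?_, ?_, ?_, ?_⟩
  · convert hmem (Sum.inl 0) using 1
    ext i
    fin_cases i <;> simp [quotientPeriod]
  · convert hmem (Sum.inl 1) using 1
    ext i
    fin_cases i <;> simp [quotientPeriod]
  · convert hmem (Sum.inl 2) using 1
    ext i
    fin_cases i <;> simp [quotientPeriod] <;> ring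
  · convert hmem (Sum.inr 0) using 1
    ext i
    fin_cases i <;> simp [quotientPeriod] <;> ring
  · convert hmem (Sum.inr 1) using 1
    ext i
    fin_cases i <;> simp [quotientPeriod] <;> ring
  · convert hmem (Sum.inr 2) using 1
    ext i
    fin_cases i <;> simp [quotientPeriod]

theorem lattice_diagPeriod_le :
    lattice (diagPeriod ω₁ ω₂) ≤ lattice (quotientPeriod ω₁ ω₂) := by
  obtain ⟨c₀, c₁, c₂, d₀, d₁, d₂⟩ := mem_lattice_quotientPeriod (ω₁ := ω₁) (ω₂ := ω₂)
  rw [lattice, AddSubgroup.closure_le]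
  rintro _ ⟨j | j, rfl⟩ <;> rw [SetLike.mem_coe] <;> fin_cases j
  · convert c₀ using 1
    ext i
    fin_cases i <;> simp [diagPeriod]
  · convert c₁ using 1
    ext i
    fin_cases i <;> simp [diagPeriod]
  · convert sub_mem (sub_mem (add_mem c₂ c₂) c₀) c₁ using 1
    ext i
    fin_cases i <;> simp [diagPeriod]
  · convert add_mem (add_mem d₀ d₀) d₂ using 1
    ext i
    fin_cases i <;> simp [diagPeriod]
  · convert add_mem (add_mem d₁ d₁) d₂ using 1
    ext i
    fin_cases i <;> simp [diagPeriod]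
  · convert d₂ using 1
    ext i
    fin_cases i <;> simp [diagPeriod]

theorem subgroupW_le : subgroupW ω₁ ω₂ ≤ (lattice (quotientPeriod ω₁ ω₂)).map
    (QuotientAddGroup.mk' (lattice (diagPeriod ω₁ ω₂))) := by
  obtain ⟨-, -, c₂, d₀, d₁, d₂⟩ := mem_lattice_quotientPeriod (ω₁ := ω₁) (ω₂ := ω₂)
  rw [subgroupW, AddSubgroup.closure_le]
  rintro _ ⟨x, hx, rfl⟩
  refine ⟨x, ?_, rfl⟩
  rw [SetLike.mem_coe]
  rcases hx with rfl | rfl | rfl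
  · convert add_mem d₁ d₂ using 1
    ext i
    fin_cases i <;> simp
    ring
  · convert add_mem (add_mem d₀ d₁) d₂ using 1
    ext i
    fin_cases i <;> simp
  · exact c₂

theorem quotientLattice_le : quotientLattice (diagPeriod ω₁ ω₂) (subgroupW ω₁ ω₂)
    ≤ lattice (quotientPeriod ω₁ ω₂) := by
  intro x hx
  obtain ⟨y, hy, hxy⟩ := subgroupW_le hx
  have h1 := lattice_diagPeriod_le (QuotientAddGroup.eq.1 hxy)
  simpa using add_mem hy h1

theorem pairing_quotientPeriod :
    pairing (quotientPeriod ω₁ ω₂) = (1 / 2 : ℂ) • pairing (diagPeriod ω₁ ω₂) := by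
  ext i j
  rw [pairing_eq, pairing_eq]
  have : starRingEnd ℂ 2 = 2 := Complex.conj_ofNat 2
  fin_cases i <;> fin_cases j <;>
    simp [this, quotientPeriod, diagPeriod, Matrix.mul_apply, Fin.sum_univ_three,
      diagonal_apply] <;> ring

theorem polarization_quotientPeriod :
    polarization (quotientPeriod ω₁ ω₂) = (2 : ℂ) • polarization (diagPeriod ω₁ ω₂) := by
  have h : (pairing (quotientPeriod ω₁ ω₂))⁻¹ = (2 : ℂ) • (pairing (diagPeriod ω₁ ω₂))⁻¹ := by
    rw [pairing_quotientPeriod]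
    by_cases hu : IsUnit (pairing (diagPeriod ω₁ ω₂)).det
    · refine Matrix.inv_eq_right_inv ?_
      rw [smul_mul_smul_comm, mul_nonsing_inv _ hu]
      norm_num
    · rw [nonsing_inv_apply_not_isUnit _ hu, nonsing_inv_apply_not_isUnit, smul_zero]
      rw [det_smul]
      exact fun h => hu (isUnit_of_mul_isUnit_right h)
  rw [polarization, polarization]
  change (2 * I) • (pairing (quotientPeriod ω₁ ω₂))⁻¹
    = _ • (2 * I) • (pairing (diagPeriod ω₁ ω₂))⁻¹
  rw [h, smul_comm]

theorem quotientPeriod_mul_stdJ :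
    quotientPeriod ω₁ ω₂ * stdJ 3 * (quotientPeriod ω₁ ω₂).transpose = 0 := by
  rw [mul_stdJ_mul_transpose]
  ext i j
  fin_cases i <;> fin_cases j <;>
    simp [quotientPeriod, Matrix.mul_apply, Fin.sum_univ_three, diagonal_apply] <;> ring

theorem det_toCols₂_quotientPeriod :
    (quotientPeriod ω₁ ω₂).toCols₂.det = (∏ i, ω₂ i) / 4 := by
  rw [quotientPeriod, toCols₂_fromCols, det_mul, det_diagonal, det_fin_three]
  simp
  ring

/-- The Riemann matrix of `quotientPeriod ω₁ ω₂` is `isogenyMatrix`. -/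
theorem toCols₁_quotientPeriod (h2 : ∀ i, ω₂ i ≠ 0) : (quotientPeriod ω₁ ω₂).toCols₁
    = (quotientPeriod ω₁ ω₂).toCols₂ * isogenyMatrix fun i => ω₁ i / ω₂ i := by
  have := h2 0
  have := h2 1
  have := h2 2
  ext i j
  fin_cases i <;> fin_cases j <;>
    simp [quotientPeriod, isogenyMatrix, Matrix.mul_apply, Fin.sum_univ_three, diagonal_apply] <;>
    field_simp <;> ring

end Quotient

end Ciani

end

theorem mainTheorem2 (ω₁ ω₂ : Fin 3 → ℂ)
    (hω : ∀ i, Ciani.pairMatrix (ω₁ i) (ω₂ i) ∈ Ciani.periodMatrices 1) :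
    Ciani.curveTriple ω₁ ω₂ ∈ Ciani.markedTriples ∧
    (Ciani.curveTriple ω₁ ω₂).Mat ∈ Ciani.S ∧
    ∀ Ω' : Ciani.PMat 3,
      Ciani.IsQuotientPeriodMatrix (Ciani.diagPeriod ω₁ ω₂) (Ciani.subgroupW ω₁ ω₂) Ω' →
        ((Real.pi : ℂ) / 2) ^ 54 * Ciani.chi18 Ω' = Ciani.X (Ciani.curveTriple ω₁ ω₂).Mat := by
  have h2 : ∀ i, ω₂ i ≠ 0 := fun i => (Ciani.ne_zero_and_im_pos_of_mem (hω i)).1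
  have him : ∀ i, 0 < (ω₁ i / ω₂ i).im := fun i => (Ciani.ne_zero_and_im_pos_of_mem (hω i)).2
  refine ⟨Ciani.curveTriple_mem_markedTriples h2 him, Ciani.mat_curveTriple_mem_S h2 him, ?_⟩
  rintro Ω' ⟨hΩ', hl, hp⟩
  have hR' : Ciani.IsRiemann Ω' := hΩ'.2
  have hpol : Ciani.polarization Ω' = Ciani.polarization (Ciani.quotientPeriod ω₁ ω₂) := by
    rw [hp, Ciani.polarization_quotientPeriod]
  have hR : Ciani.IsRiemann (Ciani.quotientPeriod ω₁ ω₂) :=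
    ⟨Ciani.quotientPeriod_mul_stdJ, hpol ▸ hR'.2⟩
  have hB := hR.isUnit_det
  have hS : Ciani.IsSiegel (Ciani.isogenyMatrix fun i => ω₁ i / ω₂ i) := by
    have := hR.isSiegel
    rwa [Ciani.riemannMatrix, Ciani.toCols₁_quotientPeriod h2, ← Matrix.mul_assoc,
      Matrix.nonsing_inv_mul _ hB, Matrix.one_mul] at this
  rw [Ciani.chi18_eq_of_lattice_le hR hR' hpol (hl ▸ Ciani.quotientLattice_le),
    Ciani.chi18_eq_of_toCols hB rfl (Ciani.toCols₁_quotientPeriod h2),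
    Ciani.det_toCols₂_quotientPeriod, Ciani.X_mat_curveTriple h2 him hS, inv_pow, mul_assoc]
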